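/- Let $k$ be a field of characteristic $0$ and $\mathcal H$ a simply connected graded commutative $k$-algebra of finite type ($\mathcal H^0=k$, $\mathcal H^1=0$, each $\mathcal H^n$ finite dimensional). Let $(R,d)\to\mathcal H$ be a weighted model, representing the formal rational homotopy space $X_{\mathcal H}$: $R$ is a free graded commutative algebra on generators that are homogeneous for total degree $n>0$ and weight $w\ge n$, $d$ is a differential that raises the total degree by $1$ and preserves the weight, and $R\to\mathcal H$ is a quasi-isomorphism that preserves the total degree and vanishes on components with $n\neq w$. A *weighted algebra* is a commutative $k$-algebra $B=\bigoplus_{n\ge 0}B_n$, graded by weight, with $B_0=k$; put $m_B=\bigoplus_{n>0}B_n$. Morphisms preserve the weight. A *weighted deformation* of $X_{\mathcal H}$ over $\operatorname{Spec} B$ is the family $\operatorname{Spec}(R\otimes B,\,d+e)\to\operatorname{Spec}B$ given by a derivation $e:R\to R\otimes m_B$ of total degree $1$ that preserves the total weight (hence lowers the weight in $R$), with $(d+e)^2=0$. An isomorphism of deformations over $B$ is a weight-preserving isomorphism of differential graded $B$-algebras that is the identity modulo $m_B$; $M(B)$ denotes the set of isomorphism classes. Families over $\operatorname{Spec}A$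 and $\operatorname{Spec}B$ are isomorphic if an isomorphism of weighted algebras $A\cong B$ carries the first to a deformation over $B$ isomorphic to the second. A weighted deformation over $V=\operatorname{Spec}A$ is *versal* if the induced map of functors $V=\operatorname{Hom}(A,-)\to M$ on weighted algebras is smooth: for every surjection $B\to B'$ with $m_{B'}^2=0$ the map $V(B)\to V(B')\times_{M(B')}M(B)$ is surjective. It is *miniversal* if, moreover, the map of tangent spaces $TV\to TM$ is an isomorphism, i.e. $V(k[\varepsilon]/\varepsilon^2)\to M(k[\varepsilon]/\varepsilon^2)$ is bijective for $\varepsilon$ of each weight $i>0$. **Theorem.** 1. Let $X\to\operatorname{Spec}A$ be a versal weighted deformation of $X_{\mathcal H}$. Assume that $R$ is of finite type (finite dimensional in each pair of total degree and weight) or that $A$ is of finite type (finite dimensional in each weight, e.g. finitely generated). Then there are a miniversal weighted deformation $Y\to\operatorname{Spec}B$ and a weighted polynomial algebra $C$ (on any set of generators, each of positive weight) such that $X\to\operatorname{Spec}A$ is isomorphic to the product of $Y\to\operatorname{Spec}B$ and the trivial family $X_{\mathcal H}\times\operatorname{Spec}C\to\operatorname{Spec}C$, that is, to the family $Y\times\operatorname{Spec}C\to\operatorname{Spec}B\times\operatorname{Spec}C=\operatorname{Spec}(B\otimes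 C)$ with total space $\operatorname{Spec}(R\otimes B\otimes C,\,d+e_Y)$, where $e_Y$ is the derivation of the family $Y$. 2. Without any finiteness assumption on $A$ or $R$: if $X\to\operatorname{Spec}A$ is a versal weighted deformation of $X_{\mathcal H}$, then for every miniversal weighted deformation $Y\to\operatorname{Spec}B$ of $X_{\mathcal H}$ there is a weighted polynomial algebra $C$ for which such an isomorphism exists. 3. In particular, any two miniversal weighted deformations of $X_{\mathcal H}$ are isomorphic (no canonical isomorphism is asserted). -/

import Mathlib

open scoped TensorProduct

universe u v w

namespace WeightedDeformation

noncomputable section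

/-! ### Weighted augmented algebras -/

/-- A weighted (conical) augmented `k`-algebra: a commutative `k`-algebra with a grading
`B = ⨁ Bₙ`, `n ≥ 0`, such that `B₀ = k`. The augmentation is the projection to `B₀ = k`. -/
structure WeightedAlgebra (k : Type u) [Field k] where
  carrier : Type u
  [commRing : CommRing carrier]
  [algebra : Algebra k carrier]
  [nontrivial : Nontrivial carrier]
  part : ℕ → Submodule k carrier
  [gradedMonoid : SetLike.GradedMonoid part]
  internal : DirectSum.IsInternal part
  connected : part 0 = 1

attribute [instance] WeightedAlgebra.commRing WeightedAlgebra.algebra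
  WeightedAlgebra.nontrivial WeightedAlgebra.gradedMonoid

instance (k : Type u) [Field k] : CoeSort (WeightedAlgebra k) (Type u) :=
  ⟨WeightedAlgebra.carrier⟩

variable {k : Type u} [Field k]

namespace WeightedAlgebra

/-- Each weight component is finite dimensional. -/
def IsFiniteType (B : WeightedAlgebra k) : Prop :=
  ∀ n, Module.Finite k (B.part n)

/-- The augmentation ideal, as a subspace: the sum of the components of positive weight. -/
def aug (B : WeightedAlgebra k) : Submodule k B :=
  ⨆ n : ℕ, B.part (n + 1)

end WeightedAlgebra

/-- Morphisms of weighted augmented algebras: algebra homomorphisms that preserve the weight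
(they are then compatible with the augmentations). -/
structure WHom (A B : WeightedAlgebra k) where
  toAlgHom : A →ₐ[k] B
  map_mem : ∀ n, ∀ a ∈ A.part n, toAlgHom a ∈ B.part n

namespace WHom

variable {A B C : WeightedAlgebra k}

instance : CoeFun (WHom A B) (fun _ => A → B) := ⟨fun f => f.toAlgHom⟩

def comp (g : WHom B C) (f : WHom A B) : WHom A C where
  toAlgHom := g.toAlgHom.comp f.toAlgHom
  map_mem n a ha := g.map_mem n _ (f.map_mem n a ha)

end WHom

/-- A family of subspaces that spans and is separated by projections is a direct sum. -/
theorem isInternal_of_proj {V : Type*} [AddCommGroup V] [Module k V] (P : ℕ → Submodule k V)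
    (π : ℕ → V →ₗ[k] V) (h₁ : ∀ n, ∀ x ∈ P n, π n x = x)
    (h₂ : ∀ m n, m ≠ n → ∀ x ∈ P m, π n x = 0) (h₃ : ⨆ n, P n = ⊤) :
    DirectSum.IsInternal P := by
  rw [DirectSum.isInternal_submodule_iff_iSupIndep_and_iSup_eq_top]
  refine ⟨fun n => ?_, h₃⟩
  rw [Submodule.disjoint_def]
  intro x hx hx'
  have hle : (⨆ (j) (_ : j ≠ n), P j) ≤ LinearMap.ker (π n) :=
    iSup₂_le fun j hj y hy => h₂ j n hj y hy
  rw [← h₁ n x hx]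
  exact hle hx'

/-- The projection to a component of a direct sum. -/
theorem exists_proj {V : Type*} [AddCommGroup V] [Module k V] (P : ℕ → Submodule k V)
    (hP : DirectSum.IsInternal P) :
    ∃ π : ℕ → V →ₗ[k] V, (∀ n, ∀ x ∈ P n, π n x = x) ∧
      (∀ m n, m ≠ n → ∀ x ∈ P m, π n x = 0) := by
  classical
  let _ := hP.chooseDecomposition
  refine ⟨fun n => (P n).subtype ∘ₗ DirectSum.component k ℕ (fun i => P i) n ∘ₗ
    (DirectSum.decomposeLinearEquiv P).toLinearMap, ?_, ?_⟩
  · intro n x hx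
    exact DirectSum.decompose_of_mem_same P hx
  · intro m n hmn x hx
    exact DirectSum.decompose_of_mem_ne P hx hmn

/-! ### The dual numbers, polynomial algebras and tensor products -/

/-- The dual numbers `k[ε]/ε²` with `ε` of weight `i > 0`. -/
def dual (k : Type u) [Field k] (i : ℕ) (hi : 0 < i) : WeightedAlgebra k where
  carrier := DualNumber k
  part n :=
    { carrier := {x | (n ≠ 0 → TrivSqZeroExt.fst x = 0) ∧ (n ≠ i → TrivSqZeroExt.snd x = 0)}
      add_mem' := by
        rintro x y ⟨h₁, h₂⟩ ⟨h₃, h₄⟩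
        exact ⟨fun h => by simp [h₁ h, h₃ h], fun h => by simp [h₂ h, h₄ h]⟩
      zero_mem' := by simp
      smul_mem' := by
        rintro c x ⟨h₁, h₂⟩
        exact ⟨fun h => by simp [h₁ h], fun h => by simp [h₂ h]⟩ }
  gradedMonoid :=
    { one_mem := by
        refine ⟨fun h => absurd rfl h, fun _ => by simp⟩
      mul_mem := by
        rintro m n x y ⟨h₁, h₂⟩ ⟨h₃, h₄⟩
        refine ⟨fun h => ?_, fun h => ?_⟩
        · rcases Nat.eq_zero_or_pos m with hm | hm
          · have : n ≠ 0 := by omega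
            simp [h₃ this]
          · simp [h₁ hm.ne']
        · simp only [TrivSqZeroExt.snd_mul, smul_eq_mul, MulOpposite.smul_eq_mul_unop,
            MulOpposite.unop_op]
          have e₁ : TrivSqZeroExt.fst x * TrivSqZeroExt.snd y = 0 := by
            by_cases hm : m = 0
            · have : n ≠ i := by omega
              simp [h₄ this]
            · simp [h₁ hm]
          have e₂ : TrivSqZeroExt.snd x * TrivSqZeroExt.fst y = 0 := by
            by_cases hn : n = 0
            · have : m ≠ i := by omega
              simp [h₂ this]
            · simp [h₃ hn]
          rw [e₁, e₂, add_zero] }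
  internal := by
    refine isInternal_of_proj _ (fun n =>
      (if n = 0 then (TrivSqZeroExt.inlAlgHom k k k).toLinearMap ∘ₗ
          (TrivSqZeroExt.fstHom k k k).toLinearMap else 0) +
      (if n = i then TrivSqZeroExt.inrHom k k ∘ₗ TrivSqZeroExt.sndHom k k else 0)) ?_ ?_ ?_
    · rintro n x ⟨h₁, h₂⟩
      by_cases hn : n = 0
      · have : n ≠ i := by omega
        have hs := h₂ this
        ext <;> simp [hn, hs, hi.ne]
      · by_cases hn' : n = i
        · have hf := h₁ hn
          ext <;> simp [hn', hf, hi.ne']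
        · have hf := h₁ hn
          have hs := h₂ hn'
          ext <;> simp [hn, hn', hf, hs]
    · rintro m n hmn x ⟨h₁, h₂⟩
      by_cases hn : n = 0
      · have hf := h₁ (by omega)
        have : n ≠ i := by omega
        ext <;> simp [hn, hf, hi.ne]
      · by_cases hn' : n = i
        · have hs := h₂ (by omega)
          ext <;> simp [hn', hs, hi.ne']
        · simp [hn, hn']
    · rw [eq_top_iff]
      intro x _
      rw [← TrivSqZeroExt.inl_fst_add_inr_snd_eq x]
      refine Submodule.add_mem _ (Submodule.mem_iSup_of_mem 0 ?_)
        (Submodule.mem_iSup_of_mem i ?_)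
      · exact ⟨fun h => absurd rfl h, fun _ => by simp⟩
      · exact ⟨fun _ => by simp, fun h => absurd rfl h⟩
  connected := by
    ext x
    rw [Submodule.mem_one]
    constructor
    · rintro ⟨-, h⟩
      refine ⟨TrivSqZeroExt.fst x, ?_⟩
      have hs := h hi.ne
      ext <;> simp [TrivSqZeroExt.algebraMap_eq_inl, hs]
    · rintro ⟨c, rfl⟩
      exact ⟨fun h => absurd rfl h, fun _ => by simp [TrivSqZeroExt.algebraMap_eq_inl]⟩

/-- The weighted polynomial algebra `k[x_s : s ∈ σ]` with `x_s` of weight `c s > 0`. -/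
def poly (k : Type u) [Field k] {σ : Type u} (c : σ → ℕ) (hc : ∀ s, 0 < c s) :
    WeightedAlgebra k where
  carrier := MvPolynomial σ k
  part n := MvPolynomial.weightedHomogeneousSubmodule k c n
  gradedMonoid := MvPolynomial.WeightedHomogeneousSubmodule.gradedMonoid
  internal := by
    classical
    let _ := MvPolynomial.weightedGradedAlgebra k c
    exact DirectSum.Decomposition.isInternal _
  connected := by
    classical
    ext p
    rw [Submodule.mem_one, MvPolynomial.mem_weightedHomogeneousSubmodule]
    constructor
    · intro hp
      refine ⟨MvPolynomial.coeff 0 p, ?_⟩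
      ext d
      rw [MvPolynomial.algebraMap_eq, MvPolynomial.coeff_C]
      split_ifs with h
      · rw [h]
      · by_contra hne
        have h0 := hp (Ne.symm hne)
        apply h
        ext s
        rw [Finsupp.weight_apply, Finsupp.sum, Finset.sum_eq_zero_iff] at h0
        by_contra hs
        have hs' : d s ≠ 0 := fun h => hs (by simp [h])
        have := h0 s (by simpa using hs')
        simp only [smul_eq_mul, mul_eq_zero] at this
        rcases this with h | h
        · exact hs' h
        · exact (hc s).ne' h
    · rintro ⟨a, rfl⟩
      exact MvPolynomial.isWeightedHomogeneous_C c a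

/-- The component of weight `n` of `B ⊗ C`. -/
def tensorPart (B C : WeightedAlgebra k) (n : ℕ) : Submodule k (B ⊗[k] C) :=
  Submodule.span k {x | ∃ i j, i + j = n ∧ ∃ b ∈ B.part i, ∃ c ∈ C.part j, x = b ⊗ₜ[k] c}

/-- The tensor product of weighted algebras, the coordinate ring of `Spec B × Spec C`. -/
def tensor (B C : WeightedAlgebra k) : WeightedAlgebra k where
  carrier := B ⊗[k] C
  nontrivial := by infer_instance
  part := tensorPart B C
  gradedMonoid :=
    { one_mem := Submodule.subset_span
        ⟨0, 0, rfl, 1, SetLike.GradedOne.one_mem, 1, SetLike.GradedOne.one_mem, rfl⟩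
      mul_mem := by
        intro m n x y hx hy
        induction hx using Submodule.span_induction with
        | zero => simp
        | add x₁ x₂ _ _ h₁ h₂ => rw [add_mul]; exact Submodule.add_mem _ h₁ h₂
        | smul a x₁ _ h₁ => rw [smul_mul_assoc]; exact Submodule.smul_mem _ a h₁
        | mem x hx =>
          obtain ⟨i, j, hij, b, hb, c, hc, rfl⟩ := hx
          induction hy using Submodule.span_induction with
          | zero => simp
          | add x₁ x₂ _ _ h₁ h₂ => rw [mul_add]; exact Submodule.add_mem _ h₁ h₂
          | smul a x₁ _ h₁ => rw [mul_smul_comm]; exact Submodule.smul_mem _ a h₁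
          | mem y hy =>
            obtain ⟨i', j', hij', b', hb', c', hc', rfl⟩ := hy
            rw [Algebra.TensorProduct.tmul_mul_tmul]
            exact Submodule.subset_span ⟨i + i', j + j', by omega, _,
              SetLike.GradedMul.mul_mem hb hb', _, SetLike.GradedMul.mul_mem hc hc', rfl⟩ }
  internal := by
    obtain ⟨p, hp₁, hp₂⟩ := exists_proj B.part B.internal
    obtain ⟨q, hq₁, hq₂⟩ := exists_proj C.part C.internal
    have key : ∀ n i j, ∀ b ∈ B.part i, ∀ c ∈ C.part j,
        (∑ ij ∈ Finset.HasAntidiagonal.antidiagonal n, TensorProduct.map (p ij.1) (q ij.2)) (b ⊗ₜ[k] c) =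
          if i + j = n then b ⊗ₜ[k] c else 0 := by
      intro n i j b hb c hc
      rw [LinearMap.sum_apply]
      split_ifs with h
      · rw [Finset.sum_eq_single_of_mem (i, j) (by simpa using h)]
        · simp [hp₁ i b hb, hq₁ j c hc]
        · rintro ⟨i', j'⟩ _ hne
          by_cases hi : i = i'
          · have hj : j ≠ j' := fun hj => hne (by rw [hi, hj])
            simp [hq₂ j j' hj c hc]
          · simp [hp₂ i i' hi b hb]
      · refine Finset.sum_eq_zero ?_
        rintro ⟨i', j'⟩ hij
        rw [Finset.HasAntidiagonal.mem_antidiagonal] at hij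
        by_cases hi : i = i'
        · have hj : j ≠ j' := by
            rintro rfl
            exact h (by rw [hi]; exact hij)
          simp [hq₂ j j' hj c hc]
        · simp [hp₂ i i' hi b hb]
    refine isInternal_of_proj _
      (fun n => ∑ ij ∈ Finset.HasAntidiagonal.antidiagonal n, TensorProduct.map (p ij.1) (q ij.2)) ?_ ?_ ?_
    · intro n x hx
      induction hx using Submodule.span_induction with
      | zero => simp
      | add x₁ x₂ _ _ h₁ h₂ => rw [map_add, h₁, h₂]
      | smul a x₁ _ h₁ => rw [map_smul, h₁]
      | mem x hx =>
        obtain ⟨i, j, hij, b, hb, c, hc, rfl⟩ := hx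
        rw [key n i j b hb c hc, if_pos hij]
    · intro m n hmn x hx
      induction hx using Submodule.span_induction with
      | zero => simp
      | add x₁ x₂ _ _ h₁ h₂ => rw [map_add, h₁, h₂, add_zero]
      | smul a x₁ _ h₁ => rw [map_smul, h₁, smul_zero]
      | mem x hx =>
        obtain ⟨i, j, hij, b, hb, c, hc, rfl⟩ := hx
        rw [key n i j b hb c hc, if_neg (by omega)]
    · rw [eq_top_iff]
      rintro x -
      induction x using TensorProduct.induction_on with
      | zero => simp
      | add x y hx hy => exact Submodule.add_mem _ hx hy
      | tmul b c =>
        have hb : b ∈ ⨆ n, B.part n := by rw [B.internal.submodule_iSup_eq_top]; trivial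
        have hc : c ∈ ⨆ n, C.part n := by rw [C.internal.submodule_iSup_eq_top]; trivial
        induction hb using Submodule.iSup_induction' with
        | zero => simp
        | add b₁ b₂ _ _ h₁ h₂ => rw [TensorProduct.add_tmul]; exact Submodule.add_mem _ h₁ h₂
        | mem i b hb =>
          induction hc using Submodule.iSup_induction' with
          | zero => simp
          | add c₁ c₂ _ _ h₁ h₂ =>
            rw [TensorProduct.tmul_add]; exact Submodule.add_mem _ h₁ h₂
          | mem j c hc =>
            exact Submodule.mem_iSup_of_mem (i + j)
              (Submodule.subset_span ⟨i, j, rfl, b, hb, c, hc, rfl⟩)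
  connected := by
    apply le_antisymm
    · refine Submodule.span_le.2 ?_
      rintro x ⟨i, j, hij, b, hb, c, hc, rfl⟩
      obtain ⟨rfl, rfl⟩ : i = 0 ∧ j = 0 := by omega
      rw [B.connected, Submodule.mem_one] at hb
      rw [C.connected, Submodule.mem_one] at hc
      obtain ⟨s, rfl⟩ := hb
      obtain ⟨t, rfl⟩ := hc
      refine Submodule.mem_one.2 ⟨s * t, ?_⟩
      rw [Algebra.TensorProduct.algebraMap_apply, Algebra.algebraMap_eq_smul_one (A := C) t,
        TensorProduct.tmul_smul, TensorProduct.smul_tmul', Algebra.smul_def, map_mul, mul_comm]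
    · rw [Submodule.one_le]
      exact Submodule.subset_span
        ⟨0, 0, rfl, 1, SetLike.GradedOne.one_mem, 1, SetLike.GradedOne.one_mem, rfl⟩

/-- The inclusion `B → B ⊗ C`, i.e. the projection `Spec B × Spec C → Spec B`. -/
def tensorInl (B C : WeightedAlgebra k) : WHom B (tensor B C) where
  toAlgHom := (Algebra.TensorProduct.includeLeft : B →ₐ[k] B ⊗[k] C)
  map_mem n b hb := by
    change b ⊗ₜ[k] (1 : C) ∈ tensorPart B C n
    exact Submodule.subset_span ⟨n, 0, rfl, b, hb, 1, SetLike.GradedOne.one_mem, rfl⟩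

/-! ### Cohomology algebras and their weighted models -/

/-- A simply connected graded commutative algebra of finite type. -/
structure SimplyConnectedCGA (k : Type u) [Field k] where
  carrier : Type w
  [ring : Ring carrier]
  [algebra : Algebra k carrier]
  [nontrivial : Nontrivial carrier]
  part : ℕ → Submodule k carrier
  [gradedMonoid : SetLike.GradedMonoid part]
  internal : DirectSum.IsInternal part
  comm : ∀ m n, ∀ a ∈ part m, ∀ b ∈ part n, a * b = (-1 : k) ^ (m * n) • (b * a)
  part_zero : part 0 = 1
  part_one : part 1 = ⊥
  finite : ∀ n, Module.Finite k (part n)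

attribute [instance] SimplyConnectedCGA.ring SimplyConnectedCGA.algebra
  SimplyConnectedCGA.nontrivial SimplyConnectedCGA.gradedMonoid

instance (k : Type u) [Field k] : CoeSort (SimplyConnectedCGA.{u, w} k) (Type w) :=
  ⟨SimplyConnectedCGA.carrier⟩

/-- A weighted differential graded commutative algebra: `part (n, w)` is the component of total
degree `n` and weight `w`; the differential raises the total degree by one and preserves
the weight; commutativity is with respect to the total degree. -/
structure WeightedDGCA (k : Type u) [Field k] where
  carrier : Type v
  [ring : Ring carrier]
  [algebra : Algebra k carrier]
  part : ℕ × ℕ → Submodule k carrier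
  [gradedMonoid : SetLike.GradedMonoid part]
  internal : DirectSum.IsInternal part
  comm : ∀ p q, ∀ a ∈ part p, ∀ b ∈ part q, a * b = (-1 : k) ^ (p.1 * q.1) • (b * a)
  d : carrier →ₗ[k] carrier
  d_mem : ∀ n w, ∀ a ∈ part (n, w), d a ∈ part (n + 1, w)
  d_mul : ∀ n w, ∀ a ∈ part (n, w), ∀ b, d (a * b) = d a * b + (-1 : k) ^ n • (a * d b)
  d_d : ∀ a, d (d a) = 0

attribute [instance] WeightedDGCA.ring WeightedDGCA.algebra WeightedDGCA.gradedMonoid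

instance (k : Type u) [Field k] : CoeSort (WeightedDGCA.{u, v} k) (Type v) :=
  ⟨WeightedDGCA.carrier⟩

/-- Each component of given total degree and weight is finite dimensional. -/
def WeightedDGCA.IsFiniteType (R : WeightedDGCA.{u, v} k) : Prop :=
  ∀ p, Module.Finite k (R.part p)

/-- A weighted model `ρ : (R, d) → (H, 0)`: the algebra `R` is the free graded commutative algebra
on bihomogeneous generators `gen s`, of positive total degree and of resolution degree
(total degree minus weight) at most zero, and `ρ` is a quasi-isomorphism that vanishes in nonzero
resolution degree. Such a pair represents the formal space `X_H`. -/
structure WeightedModel (R : WeightedDGCA.{u, v} k) (H : SimplyConnectedCGA.{u, w} k) where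
  index : Type v
  gen : index → R
  deg : index → ℕ
  wt : index → ℕ
  gen_mem : ∀ s, gen s ∈ R.part (deg s, wt s)
  deg_pos : ∀ s, 0 < deg s
  deg_le_wt : ∀ s, deg s ≤ wt s
  /-- The generators generate `R`. -/
  gen_surjective : Function.Surjective (FreeAlgebra.lift k gen)
  /-- All relations between them follow from graded commutativity. -/
  gen_relations : TwoSidedIdeal.ker (FreeAlgebra.lift k gen) =
    TwoSidedIdeal.span {x | ∃ s t, x = FreeAlgebra.ι k s * FreeAlgebra.ι k t -
      (-1 : k) ^ (deg s * deg t) • (FreeAlgebra.ι k t * FreeAlgebra.ι k s)}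
  ρ : R →ₐ[k] H
  ρ_mem : ∀ n w, ∀ a ∈ R.part (n, w), ρ a ∈ H.part n
  ρ_eq_zero : ∀ n w, n ≠ w → ∀ a ∈ R.part (n, w), ρ a = 0
  ρ_d : ∀ a, ρ (R.d a) = 0
  ρ_cohomology_surjective : ∀ h : H, ∃ a, R.d a = 0 ∧ ρ a = h
  ρ_cohomology_injective : ∀ a, R.d a = 0 → ρ a = 0 → ∃ b, R.d b = a

/-! ### Deformations over a weighted base -/

/-- The part of `B ⊗ R` of total degree `n` and total weight `w` that lies in `m_B ⊗ R`. Since the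
weights of `m_B` are positive, the weights of the factors from `R` are smaller than `w`. -/
def lowPart (R : WeightedDGCA.{u, v} k) (B : WeightedAlgebra k) (n w : ℕ) :
    Submodule k (B ⊗[k] R) :=
  Submodule.span k {x | ∃ i j, 0 < i ∧ i + j = w ∧
    ∃ b ∈ B.part i, ∃ r ∈ R.part (n, j), x = b ⊗ₜ[k] r}

/-- For `e : R → B ⊗ R`, the `B`-linear endomorphism `d + e` of `B ⊗ R`. -/
def totalD (R : WeightedDGCA.{u, v} k) (B : WeightedAlgebra k) (e : R →ₗ[k] B ⊗[k] R) :
    B ⊗[k] R →ₗ[B] B ⊗[k] R :=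
  R.d.baseChange B + e.liftBaseChange B

/-- A weighted deformation, parametrized by `Spec B`, of the space with model `R`:
a derivation `e` of degree one from `R` to `m_B ⊗ R` that preserves the total weight
(hence lowers the weight filtration of `R`), with `(d + e)² = 0`. The family is
`Spec (B ⊗ R, d + e) → Spec B`. -/
structure Deformation (R : WeightedDGCA.{u, v} k) (B : WeightedAlgebra k) where
  e : R →ₗ[k] B ⊗[k] R
  leibniz : ∀ n w, ∀ a ∈ R.part (n, w), ∀ b,
    e (a * b) = e a * (1 ⊗ₜ[k] b) + (-1 : k) ^ n • ((1 ⊗ₜ[k] a) * e b)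
  mem_lowPart : ∀ n w, ∀ a ∈ R.part (n, w), e a ∈ lowPart R B (n + 1) w
  sq_zero : totalD R B e ∘ₗ totalD R B e = 0

namespace Deformation

variable {R : WeightedDGCA.{u, v} k} {A B C : WeightedAlgebra k}

/-- The differential `d + e` of the total space. -/
def D (E : Deformation R B) : B ⊗[k] R →ₗ[B] B ⊗[k] R := totalD R B E.e

/-- The map `R ⊗ A → R ⊗ B` induced by `f : A → B`. -/
def baseMap (R : WeightedDGCA.{u, v} k) (f : WHom A B) : A ⊗[k] R →ₐ[k] B ⊗[k] R :=
  Algebra.TensorProduct.map f.toAlgHom (AlgHom.id k R)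

@[simp] theorem baseMap_tmul (f : WHom A B) (a : A) (r : R) :
    baseMap R f (a ⊗ₜ r) = f a ⊗ₜ r := by
  simp [baseMap]

theorem baseMap_smul (f : WHom A B) (a : A) (x : A ⊗[k] R) :
    baseMap R f (a • x) = f a • baseMap R f x := by
  induction x using TensorProduct.induction_on with
  | zero => simp
  | add x y hx hy => simp only [smul_add, map_add, hx, hy]
  | tmul b r => simp [TensorProduct.smul_tmul']

theorem baseMap_lowPart (f : WHom A B) (n w : ℕ) (x : A ⊗[k] R) (hx : x ∈ lowPart R A n w) :
    baseMap R f x ∈ lowPart R B n w := by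
  induction hx using Submodule.span_induction with
  | zero => simp
  | add x₁ x₂ _ _ h₁ h₂ => rw [map_add]; exact Submodule.add_mem _ h₁ h₂
  | smul a x₁ _ h₁ => rw [map_smul]; exact Submodule.smul_mem _ a h₁
  | mem x hx =>
    obtain ⟨i, j, hi, hij, b, hb, r, hr, rfl⟩ := hx
    rw [baseMap_tmul]
    exact Submodule.subset_span ⟨i, j, hi, hij, _, f.map_mem i b hb, r, hr, rfl⟩

theorem totalD_baseMap (f : WHom A B) (e : R →ₗ[k] A ⊗[k] R) (x : A ⊗[k] R) :
    totalD R B ((baseMap R f).toLinearMap ∘ₗ e) (baseMap R f x) =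
      baseMap R f (totalD R A e x) := by
  induction x using TensorProduct.induction_on with
  | zero => simp
  | add x y hx hy => simp only [map_add, hx, hy]
  | tmul b r => simp [totalD, baseMap_smul]

/-- The pullback of a family along `Spec B → Spec A`. -/
def map (E : Deformation R A) (f : WHom A B) : Deformation R B where
  e := (baseMap R f).toLinearMap ∘ₗ E.e
  leibniz n w a ha b := by
    simp [E.leibniz n w a ha b]
  mem_lowPart n w a ha := baseMap_lowPart f _ _ _ (E.mem_lowPart n w a ha)
  sq_zero := by
    ext r
    have h₁ : (1 : B) ⊗ₜ[k] r = baseMap R f ((1 : A) ⊗ₜ[k] r) := by simp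
    have h₂ := LinearMap.congr_fun E.sq_zero ((1 : A) ⊗ₜ[k] r)
    simp only [LinearMap.comp_apply, LinearMap.zero_apply] at h₂
    simp only [TensorProduct.AlgebraTensorModule.curry_apply, LinearMap.restrictScalars_comp,
      TensorProduct.curry_apply, LinearMap.comp_apply, LinearMap.coe_restrictScalars]
    rw [h₁, totalD_baseMap, totalD_baseMap, h₂, map_zero]
    simp

/-- Isomorphism of deformations over the same base: an isomorphism of weighted differential graded
`B`-algebras `(B ⊗ R, d + e) ≃ (B ⊗ R, d + e')` that induces the identity of the special fibre,
i.e. is the identity modulo `m_B`. -/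
def IsIso (E E' : Deformation R B) : Prop :=
  ∃ φ : B ⊗[k] R ≃ₐ[B] B ⊗[k] R,
    (∀ n w, ∀ a ∈ R.part (n, w), φ (1 ⊗ₜ[k] a) - 1 ⊗ₜ[k] a ∈ lowPart R B n w) ∧
    ∀ x, φ (E.D x) = E'.D (φ x)

theorem smul_lowPart {i j n : ℕ} {b : B} (hb : b ∈ B.part i) {x : B ⊗[k] R}
    (hx : x ∈ lowPart R B n j) : b • x ∈ lowPart R B n (i + j) := by
  induction hx using Submodule.span_induction with
  | zero => simp
  | add x₁ x₂ _ _ h₁ h₂ => rw [smul_add]; exact Submodule.add_mem _ h₁ h₂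
  | smul a x₁ _ h₁ => rw [smul_comm]; exact Submodule.smul_mem _ a h₁
  | mem x hx =>
    obtain ⟨i', j', hi', hij', b', hb', r, hr, rfl⟩ := hx
    exact Submodule.subset_span ⟨i + i', j', by omega, by omega, _,
      SetLike.GradedMul.mul_mem hb hb', r, hr, by simp [TensorProduct.smul_tmul']⟩

/-- If a `B`-algebra map is the identity modulo `m_B` in weights below `w`, it preserves the
parts `lowPart R B n w`. -/
theorem map_lowPart (φ : B ⊗[k] R →ₐ[B] B ⊗[k] R) (n w : ℕ)
    (hφ : ∀ j < w, ∀ a ∈ R.part (n, j), φ (1 ⊗ₜ[k] a) - 1 ⊗ₜ[k] a ∈ lowPart R B n j)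
    (x : B ⊗[k] R) (hx : x ∈ lowPart R B n w) : φ x ∈ lowPart R B n w := by
  induction hx using Submodule.span_induction with
  | zero => simp
  | add x₁ x₂ _ _ h₁ h₂ => rw [map_add]; exact Submodule.add_mem _ h₁ h₂
  | smul a x₁ _ h₁ =>
    have h := map_smul (φ.restrictScalars k) a x₁
    rw [AlgHom.restrictScalars_apply, AlgHom.restrictScalars_apply] at h
    rw [h]
    exact Submodule.smul_mem _ a h₁
  | mem x hx =>
    obtain ⟨i, j, hi, hij, b, hb, r, hr, rfl⟩ := hx
    have h₁ : b ⊗ₜ[k] r = b • ((1 : B) ⊗ₜ[k] r) := by simp [TensorProduct.smul_tmul']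
    have h₂ : φ (b ⊗ₜ[k] r) = b • (φ (1 ⊗ₜ[k] r) - 1 ⊗ₜ[k] r) + b ⊗ₜ[k] r := by
      rw [h₁, map_smul, smul_sub, sub_add_cancel]
    rw [h₂]
    refine Submodule.add_mem _ ?_ (Submodule.subset_span ⟨i, j, hi, hij, b, hb, r, hr, rfl⟩)
    have h₃ := smul_lowPart hb (hφ j (by omega) r hr)
    rwa [hij] at h₃

theorem IsIso.refl (E : Deformation R B) : IsIso E E :=
  ⟨AlgEquiv.refl, fun n w a _ => by simp, fun x => by simp⟩

theorem IsIso.symm {E E' : Deformation R B} (h : IsIso E E') : IsIso E' E := by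
  obtain ⟨φ, h₁, h₂⟩ := h
  refine ⟨φ.symm, ?_, fun x => ?_⟩
  · intro n w
    induction w using Nat.strong_induction_on with
    | _ w ih =>
      intro a ha
      have h₃ : φ.symm (1 ⊗ₜ[k] a) - 1 ⊗ₜ[k] a =
          - φ.symm (φ (1 ⊗ₜ[k] a) - 1 ⊗ₜ[k] a) := by
        rw [map_sub, AlgEquiv.symm_apply_apply]; abel
      rw [h₃]
      exact Submodule.neg_mem _
        (map_lowPart φ.symm.toAlgHom n w (fun j hj a ha => ih j hj a ha) _ (h₁ n w a ha))
  · rw [AlgEquiv.symm_apply_eq, h₂, AlgEquiv.apply_symm_apply]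

theorem IsIso.trans {E E' E'' : Deformation R B} (h : IsIso E E') (h' : IsIso E' E'') :
    IsIso E E'' := by
  obtain ⟨φ, h₁, h₂⟩ := h
  obtain ⟨ψ, h₃, h₄⟩ := h'
  refine ⟨φ.trans ψ, fun n w a ha => ?_, fun x => ?_⟩
  · have h₅ : (φ.trans ψ) (1 ⊗ₜ[k] a) - 1 ⊗ₜ[k] a =
        ψ (φ (1 ⊗ₜ[k] a) - 1 ⊗ₜ[k] a) + (ψ (1 ⊗ₜ[k] a) - 1 ⊗ₜ[k] a) := by
      rw [map_sub, AlgEquiv.trans_apply]; abel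
    rw [h₅]
    exact Submodule.add_mem _
      (map_lowPart ψ.toAlgHom n w (fun j _ a ha => h₃ n j a ha) _ (h₁ n w a ha)) (h₃ n w a ha)
  · rw [AlgEquiv.trans_apply, AlgEquiv.trans_apply, h₂, h₄]

instance setoid (R : WeightedDGCA.{u, v} k) (B : WeightedAlgebra k) : Setoid (Deformation R B) where
  r := IsIso
  iseqv := ⟨IsIso.refl, IsIso.symm, IsIso.trans⟩

end Deformation

/-- The moduli functor: `Moduli R B` is the set `M(B)` of deformations parametrized by `Spec B`,
modulo isomorphism. -/
def Moduli (R : WeightedDGCA.{u, v} k) (B : WeightedAlgebra k) : Type (max u v) :=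
  Quotient (Deformation.setoid R B)

namespace Deformation

variable {R : WeightedDGCA.{u, v} k} {A B C : WeightedAlgebra k}

/-- Pullback along `Spec B → Spec A` respects isomorphism. -/
theorem IsIso.map {E E' : Deformation R A} (h : IsIso E E') (f : WHom A B) :
    IsIso (E.map f) (E'.map f) := by
  obtain ⟨φ, h₁, h₂⟩ := h
  let ext' (ψ : A ⊗[k] R →ₐ[A] A ⊗[k] R) : B ⊗[k] R →ₐ[B] B ⊗[k] R :=
    Algebra.TensorProduct.lift (Algebra.ofId B (B ⊗[k] R))
      ((baseMap R f).comp ((ψ.restrictScalars k).comp Algebra.TensorProduct.includeRight))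
      (fun b r => Algebra.commutes b _)
  have hext₁ : ∀ (ψ : A ⊗[k] R →ₐ[A] A ⊗[k] R) (r : R),
      ext' ψ (1 ⊗ₜ[k] r) = baseMap R f (ψ (1 ⊗ₜ[k] r)) := by
    intro ψ r
    refine (Algebra.TensorProduct.lift_tmul _ _ _ _ _).trans ?_
    rw [map_one, one_mul]
    simp
  have hext : ∀ (ψ : A ⊗[k] R →ₐ[A] A ⊗[k] R) (x : A ⊗[k] R),
      ext' ψ (baseMap R f x) = baseMap R f (ψ x) := by
    intro ψ x
    induction x using TensorProduct.induction_on with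
    | zero => simp
    | add x y hx hy => simp only [map_add, hx, hy]
    | tmul a r =>
      have e₁ : a ⊗ₜ[k] r = a • ((1 : A) ⊗ₜ[k] r) := by simp [TensorProduct.smul_tmul']
      have e₂ : baseMap R f ((1 : A) ⊗ₜ[k] r) = 1 ⊗ₜ[k] r := by simp
      rw [e₁, baseMap_smul, map_smul, map_smul, baseMap_smul, e₂, hext₁]
  have hinv : ∀ ψ χ : A ⊗[k] R →ₐ[A] A ⊗[k] R, (∀ x, ψ (χ x) = x) →
      (ext' ψ).comp (ext' χ) = AlgHom.id B _ := by
    intro ψ χ hψ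
    ext r
    simp [hext₁, hext, hψ]
  refine ⟨AlgEquiv.ofAlgHom (ext' φ.toAlgHom) (ext' φ.symm.toAlgHom)
    (hinv _ _ (fun x => by simp)) (hinv _ _ (fun x => by simp)), ?_, ?_⟩
  · intro n w a ha
    have e₂ : baseMap R f ((1 : A) ⊗ₜ[k] a) = 1 ⊗ₜ[k] a := by simp
    change ext' φ.toAlgHom (1 ⊗ₜ[k] a) - 1 ⊗ₜ[k] a ∈ _
    rw [hext₁, ← e₂, ← map_sub]
    exact baseMap_lowPart f n w _ (h₁ n w a ha)
  · intro x
    change ext' φ.toAlgHom ((E.map f).D x) = (E'.map f).D (ext' φ.toAlgHom x)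
    induction x using TensorProduct.induction_on with
    | zero => simp
    | add x y hx hy => simp only [map_add, hx, hy]
    | tmul b r =>
      have e₁ : b ⊗ₜ[k] r = b • baseMap R f ((1 : A) ⊗ₜ[k] r) := by
        simp [TensorProduct.smul_tmul']
      have e₃ : ∀ (E : Deformation R A) x, (E.map f).D (baseMap R f x) = baseMap R f (E.D x) :=
        fun E x => totalD_baseMap f E.e x
      rw [e₁]
      simp only [map_smul, hext, e₃]
      exact congrArg (fun z => b • baseMap R f z) (h₂ _)

end Deformation

/-- The map `M(A) → M(B)` induced by `f : A → B`. -/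
def Moduli.map {R : WeightedDGCA.{u, v} k} {A B : WeightedAlgebra k} (f : WHom A B) :
    Moduli R A → Moduli R B :=
  Quotient.map (fun E => E.map f) (fun _ _ h => Deformation.IsIso.map h f)

namespace Deformation

variable {R : WeightedDGCA.{u, v} k} {A B C : WeightedAlgebra k}

/-- The map of functors `V → M`, `V = Spec A`, induced by a deformation over `V`; here
`V(B) = Hom(A, B)`. -/
def classify (E : Deformation R A) (B : WeightedAlgebra k) (f : WHom A B) : Moduli R B :=
  Quotient.mk (setoid R B) (E.map f)

/-- A weighted deformation over `V = Spec A` is versal if the map of functors `V → M` is smooth: for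
each surjection `B → B'` with `(m_{B'})² = 0`, the map `V(B) → V(B') ×_{M(B')} M(B)` is
surjective. -/
def IsVersal (E : Deformation R A) : Prop :=
  ∀ (B B' : WeightedAlgebra k) (p : WHom B B'), Function.Surjective p →
    (∀ x ∈ B'.aug, ∀ y ∈ B'.aug, x * y = 0) →
    ∀ (f' : WHom A B') (m : Moduli R B), E.classify B' f' = Moduli.map p m →
      ∃ f : WHom A B, p.comp f = f' ∧ E.classify B f = m

/-- A weighted deformation over `V = Spec A` is miniversal if it is versal and the Kodaira-Spencer map
`TV → TM` is an isomorphism. The tangent spaces are graded, with component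
`V(k[ε]) → M(k[ε])`, `ε² = 0`, `ε` of weight `i`, for each `i > 0`. -/
def IsMiniversal (E : Deformation R A) : Prop :=
  E.IsVersal ∧ ∀ (i : ℕ) (hi : 0 < i), Function.Bijective (E.classify (dual k i hi))

/-- The product of a family over `Spec B` with the trivial family with base `Spec C`: the family over
`Spec B × Spec C` with total space `Spec (B ⊗ R, d + e) × Spec C`. -/
def prodTrivial (E : Deformation R B) (C : WeightedAlgebra k) : Deformation R (tensor B C) :=
  E.map (tensorInl B C)

/-- Isomorphism of families with possibly different bases: an isomorphism of the bases along
which the families correspond, up to isomorphism. -/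
def FamilyIso (E : Deformation R A) (F : Deformation R B) : Prop :=
  ∃ f : WHom A B, Function.Bijective f ∧ IsIso (E.map f) F

end Deformation

end

end WeightedDeformation

namespace WeightedDeformation

noncomputable section

variable {k : Type u} [Field k]

/-! ### Augmentation ideals, homogeneous quotients and first order neighbourhoods. -/

namespace WeightedAlgebra

variable (A : WeightedAlgebra k)

/-! Positivity of the weights plays the role of completeness. The power `m ^ j` lives in weights at
least `j`, so an endomorphism that is the identity modulo `m²` is bijective
(`WHom.bijective_of_toFirstOrder_comp`). Smoothness is required for every surjection onto a square
zero algebra, whatever its kernel, so a single lift leads from `k` to `B`, or from `P / m²` to `P`.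
Hence a versal family induces all others (`IsVersal.exists_isIso`), and the rest is a matter of
first order.

Uniqueness: two miniversal families induce each other. The composites fix all tangent vectors,
because the Kodaira-Spencer map is injective, and are therefore bijective
(`IsMiniversal.familyIso`).

Product: a versal family over `A` and a miniversal one over `B` give `f : A → B` and `g : B → A`
with `f ∘ g` the identity modulo `m²`. Polynomial variables are introduced for a basis of `A` modulo
`g(B) + m²`. To first order, `f` plus these coordinates maps `A` to `B ⊗ C`. Versality lifts this to
a morphism that carries the family to the product, and it is invertible modulo `m²`
(`IsVersal.exists_familyIso`).

Existence: `Spec A` is cut by equations `l s = 0` whose differentials are coordinates on the kernel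
of the Kodaira-Spencer map. The family is constant to first order in these directions. By versality
it can be moved along them without changing it up to isomorphism, and an implicit function argument
moves every point into the slice. So the family is induced from the slice, over which it is
miniversal (`IsVersal.exists_isMiniversal`).

Finiteness serves only to provide the equations. In each weight, the kernel must be the annihilator
of a subspace `N` of `A`, and vector-valued maps that vanish on `N` must also be infinitesimally
trivial (`IsKSSubspace`). For `A` of finite type this is duality of finite dimensional spaces. For
`R` of finite type, infinitesimal triviality is a linear system, and `N` consists of its
compatibility conditions. -/

instance gradedAlgebra : GradedAlgebra A.part :=
  { A.gradedMonoid, A.internal.chooseDecomposition with }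

/-- The projection to the component of weight `n`. -/
def proj (n : ℕ) : A →ₗ[k] A := GradedAlgebra.proj A.part n

/-- The augmentation ideal. -/
def maxIdeal : Ideal A := (HomogeneousIdeal.irrelevant A.part).toIdeal

variable {A}

theorem proj_mem (n : ℕ) (a : A) : A.proj n a ∈ A.part n := by
  simp [proj, GradedAlgebra.proj_apply]

theorem proj_of_mem {n : ℕ} {a : A} (ha : a ∈ A.part n) : A.proj n a = a := by
  rw [proj, GradedAlgebra.proj_apply, DirectSum.decompose_of_mem_same _ ha]

theorem proj_of_ne {m n : ℕ} (hmn : m ≠ n) {a : A} (ha : a ∈ A.part m) : A.proj n a = 0 := by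
  rw [proj, GradedAlgebra.proj_apply, DirectSum.decompose_of_mem_ne _ ha hmn]

theorem part_induction {P : A → Prop} (zero : P 0) (mem : ∀ n, ∀ a ∈ A.part n, P a)
    (add : ∀ a b, P a → P b → P (a + b)) (a : A) : P a := by
  have ha : a ∈ ⨆ n, A.part n := by rw [A.internal.submodule_iSup_eq_top]; trivial
  induction ha using Submodule.iSup_induction' with
  | zero => exact zero
  | add b c _ _ hb hc => exact add b c hb hc
  | mem i b hb => exact mem i b hb

theorem mem_maxIdeal_iff {a : A} : a ∈ A.maxIdeal ↔ A.proj 0 a = 0 := by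
  rw [maxIdeal, HomogeneousIdeal.mem_iff, HomogeneousIdeal.mem_irrelevant_iff]
  rfl

theorem mem_maxIdeal_of_part {n : ℕ} (hn : 0 < n) {a : A} (ha : a ∈ A.part n) :
    a ∈ A.maxIdeal := mem_maxIdeal_iff.2 (proj_of_ne hn.ne' ha)

theorem mem_aug_iff {a : A} : a ∈ A.aug ↔ a ∈ A.maxIdeal := by
  constructor
  · intro h
    have : A.aug ≤ A.maxIdeal.restrictScalars k :=
      iSup_le fun n a ha => mem_maxIdeal_of_part n.succ_pos ha
    exact this h
  · intro h
    have key : ∀ b : A, b - A.proj 0 b ∈ A.aug := by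
      intro b
      induction b using part_induction with
      | zero => simp
      | add b c hb hc => simpa [add_sub_add_comm] using A.aug.add_mem hb hc
      | mem n b hb =>
        cases n with
        | zero => simp [proj_of_mem hb]
        | succ n =>
          rw [proj_of_ne (by omega) hb, sub_zero]
          exact Submodule.mem_iSup_of_mem n hb
    simpa [mem_maxIdeal_iff.1 h] using key a

theorem exists_algebraMap_of_mem_zero {a : A} (ha : a ∈ A.part 0) :
    ∃ c : k, algebraMap k A c = a := by
  rwa [A.connected, Submodule.mem_one] at ha

theorem algebraMap_mem (c : k) : algebraMap k A c ∈ A.part 0 := by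
  rw [A.connected, Submodule.mem_one]; exact ⟨c, rfl⟩

theorem exists_add_mem_maxIdeal (a : A) :
    ∃ (c : k) (b : A), b ∈ A.maxIdeal ∧ a = algebraMap k A c + b := by
  obtain ⟨c, hc⟩ := exists_algebraMap_of_mem_zero (proj_mem 0 a)
  refine ⟨c, a - A.proj 0 a, ?_, by rw [hc]; abel⟩
  rw [mem_maxIdeal_iff, map_sub, proj_of_mem (proj_mem 0 a), sub_self]

theorem maxIdeal_induction {P : A → Prop} (zero : P 0)
    (mem : ∀ n, 0 < n → ∀ a ∈ A.part n, P a)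
    (add : ∀ a b, P a → P b → P (a + b)) {a : A} (ha : a ∈ A.maxIdeal) : P a := by
  have h := mem_aug_iff.2 ha
  induction h using Submodule.iSup_induction' with
  | zero => exact zero
  | add b c hb' hc' hb hc => exact add b c (hb (mem_aug_iff.1 hb')) (hc (mem_aug_iff.1 hc'))
  | mem i b hb => exact mem _ i.succ_pos b hb

theorem maxIdeal_isHomogeneous : A.maxIdeal.IsHomogeneous A.part :=
  (HomogeneousIdeal.irrelevant A.part).isHomogeneous

theorem maxIdeal_sq_isHomogeneous : (A.maxIdeal ^ 2).IsHomogeneous A.part := by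
  rw [pow_two]
  exact maxIdeal_isHomogeneous.mul maxIdeal_isHomogeneous

theorem proj_mem_of_isHomogeneous {I : Ideal A} (hI : I.IsHomogeneous A.part) (n : ℕ) {a : A}
    (ha : a ∈ I) : A.proj n a ∈ I := hI n ha

/-- Elements of `m` have components of weight at least one only, so products of `j` of them start in
weight `j`. In a fixed weight, `m`-adic approximation therefore stops after finitely many steps. -/
theorem proj_eq_zero_of_mem_pow {j n : ℕ} (hn : n < j) {a : A} (ha : a ∈ A.maxIdeal ^ j) :
    A.proj n a = 0 := by
  have key : ∀ j, ∀ a ∈ A.maxIdeal ^ j, a ∈ ⨆ n, A.part (n + j) := by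
    intro j
    induction j with
    | zero =>
      intro a _
      rw [show (⨆ n, A.part (n + 0)) = ⨆ n, A.part n from rfl, A.internal.submodule_iSup_eq_top]
      trivial
    | succ j ih =>
      intro a ha
      rw [pow_succ] at ha
      induction ha using Submodule.mul_induction_on' with
      | add x _ y _ hx hy => exact Submodule.add_mem _ hx hy
      | mem_mul_mem x hx y hy =>
        have hx' := ih x hx
        have hy' : y ∈ ⨆ n, A.part (n + 1) := mem_aug_iff.2 hy
        have := Submodule.mul_mem_mul hx' hy'
        rw [Submodule.iSup_mul] at this
        refine (iSup_le fun m => ?_ : _ ≤ ⨆ n, A.part (n + (j + 1))) this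
        rw [Submodule.mul_iSup]
        refine iSup_le fun n => Submodule.mul_le.2 fun b hb c hc => ?_
        refine Submodule.mem_iSup_of_mem (m + n) ?_
        rw [show m + n + (j + 1) = m + j + (n + 1) by omega]
        exact SetLike.GradedMul.mul_mem hb hc
  have hle : (⨆ n, A.part (n + j)) ≤ LinearMap.ker (A.proj n) :=
    iSup_le fun m b hb => proj_of_ne (by omega) hb
  exact hle (key j a ha)

theorem map_mem_maxIdeal {A B : WeightedAlgebra k} (f : WHom A B) {a : A}
    (ha : a ∈ A.maxIdeal) : f a ∈ B.maxIdeal := by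
  refine maxIdeal_induction (P := fun a => f a ∈ B.maxIdeal) (by simp)
    (fun n hn a ha => mem_maxIdeal_of_part hn (f.map_mem n a ha)) (fun a b ha hb => ?_) ha
  rw [map_add]
  exact Ideal.add_mem _ ha hb

theorem map_maxIdeal_sq_mem {A B : WeightedAlgebra k} (f : WHom A B) {a : A}
    (ha : a ∈ A.maxIdeal ^ 2) : f a ∈ B.maxIdeal ^ 2 := by
  have h1 : A.maxIdeal ≤ B.maxIdeal.comap f.toAlgHom := by
    intro a ha
    exact map_mem_maxIdeal f ha
  have h2 := Ideal.pow_right_mono h1 2 ha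
  exact Ideal.le_comap_pow f.toAlgHom 2 h2

/-- The quotient of a weighted algebra by a homogeneous ideal. -/
def quot (A : WeightedAlgebra k) (I : Ideal A) (hI : I.IsHomogeneous A.part)
    (hle : I ≤ A.maxIdeal) : WeightedAlgebra k where
  carrier := A ⧸ I
  nontrivial := by
    refine Ideal.Quotient.nontrivial_iff.2 fun h => ?_
    have h1 : (1 : A) ∈ A.maxIdeal := hle (by rw [h]; trivial)
    rw [mem_maxIdeal_iff, proj_of_mem (SetLike.GradedOne.one_mem)] at h1
    exact one_ne_zero h1
  part n := (A.part n).map (Ideal.Quotient.mkₐ k I).toLinearMap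
  gradedMonoid :=
    { one_mem := ⟨1, SetLike.GradedOne.one_mem, map_one (Ideal.Quotient.mkₐ k I)⟩
      mul_mem := by
        rintro i j _ _ ⟨a, ha, rfl⟩ ⟨b, hb, rfl⟩
        exact ⟨a * b, SetLike.GradedMul.mul_mem ha hb, map_mul (Ideal.Quotient.mkₐ k I) a b⟩ }
  internal := by
    let e := Submodule.Quotient.restrictScalarsEquiv k I
    let π : ℕ → (A ⧸ I) →ₗ[k] (A ⧸ I) := fun n => e.toLinearMap ∘ₗ
      (Submodule.mapQ (I.restrictScalars k) (I.restrictScalars k) (A.proj n)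
        fun a ha => hI n ha) ∘ₗ e.symm.toLinearMap
    have hπ : ∀ n a, π n (Ideal.Quotient.mkₐ k I a) = Ideal.Quotient.mkₐ k I (A.proj n a) :=
      fun n a => rfl
    refine isInternal_of_proj _ π ?_ ?_ ?_
    · rintro n _ ⟨a, ha, rfl⟩
      rw [AlgHom.toLinearMap_apply, hπ, proj_of_mem ha]
    · rintro m n hmn _ ⟨a, ha, rfl⟩
      rw [AlgHom.toLinearMap_apply, hπ, proj_of_ne hmn ha, map_zero]
    · rw [← Submodule.map_iSup, A.internal.submodule_iSup_eq_top, Submodule.map_top,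
        LinearMap.range_eq_top]
      exact Ideal.Quotient.mkₐ_surjective k I
  connected := by
    rw [A.connected, Submodule.one_eq_range, Submodule.one_eq_range, ← LinearMap.range_comp]
    rfl

/-- The projection to a quotient. -/
def mkQuot (I : Ideal A) (hI : I.IsHomogeneous A.part) (hle : I ≤ A.maxIdeal) :
    WHom A (A.quot I hI hle) where
  toAlgHom := Ideal.Quotient.mkₐ k I
  map_mem _ a ha := ⟨a, ha, rfl⟩

theorem mkQuot_surjective (I : Ideal A) (hI : I.IsHomogeneous A.part) (hle : I ≤ A.maxIdeal) :
    Function.Surjective (mkQuot I hI hle) := Ideal.Quotient.mkₐ_surjective k I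

theorem mkQuot_eq_iff {I : Ideal A} {hI : I.IsHomogeneous A.part} {hle : I ≤ A.maxIdeal}
    {a b : A} : mkQuot I hI hle a = mkQuot I hI hle b ↔ a - b ∈ I :=
  Ideal.Quotient.eq

theorem exists_mem_part_of_quot {I : Ideal A} {hI : I.IsHomogeneous A.part}
    {hle : I ≤ A.maxIdeal} {n : ℕ} {x : A.quot I hI hle} (hx : x ∈ (A.quot I hI hle).part n) :
    ∃ a ∈ A.part n, mkQuot I hI hle a = x := hx

/-- Factorization of a morphism through a quotient. -/
def liftQuot {B : WeightedAlgebra k} (I : Ideal A) (hI : I.IsHomogeneous A.part)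
    (hle : I ≤ A.maxIdeal) (f : WHom A B) (hf : ∀ a ∈ I, f a = 0) : WHom (A.quot I hI hle) B where
  toAlgHom := Ideal.Quotient.liftₐ I f.toAlgHom hf
  map_mem := by
    rintro n _ ⟨a, ha, rfl⟩
    exact f.map_mem n a ha

/-- Products of elements of positive weight vanish. -/
def IsSquareZero (A : WeightedAlgebra k) : Prop :=
  ∀ x ∈ A.aug, ∀ y ∈ A.aug, x * y = 0

theorem IsSquareZero.mul_eq_zero (h : A.IsSquareZero) {x y : A} (hx : x ∈ A.maxIdeal)
    (hy : y ∈ A.maxIdeal) : x * y = 0 := h x (mem_aug_iff.2 hx) y (mem_aug_iff.2 hy)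

theorem IsSquareZero.map_eq_zero {B : WeightedAlgebra k} (h : B.IsSquareZero) (f : WHom A B)
    {a : A} (ha : a ∈ A.maxIdeal ^ 2) : f a = 0 := by
  have h1 := map_maxIdeal_sq_mem f ha
  have h2 : B.maxIdeal ^ 2 ≤ ⊥ := by
    rw [pow_two, Ideal.mul_le]
    exact fun x hx y hy => h.mul_eq_zero hx hy
  exact h2 h1

variable (A) in
/-- The first order neighbourhood `A / m²`. -/
def firstOrder : WeightedAlgebra k :=
  A.quot (A.maxIdeal ^ 2) maxIdeal_sq_isHomogeneous (Ideal.pow_le_self two_ne_zero)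

variable (A) in
/-- The projection `A → A / m²`. -/
def toFirstOrder : WHom A A.firstOrder := mkQuot _ _ _

theorem toFirstOrder_surjective : Function.Surjective A.toFirstOrder := mkQuot_surjective _ _ _

theorem toFirstOrder_eq_iff {a b : A} :
    A.toFirstOrder a = A.toFirstOrder b ↔ a - b ∈ A.maxIdeal ^ 2 := mkQuot_eq_iff

theorem exists_mem_maxIdeal_of_quot {I : Ideal A} {hI : I.IsHomogeneous A.part}
    {hle : I ≤ A.maxIdeal} {x : A.quot I hI hle} (hx : x ∈ (A.quot I hI hle).maxIdeal) :
    ∃ a ∈ A.maxIdeal, mkQuot I hI hle a = x := by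
  refine maxIdeal_induction (P := fun x => ∃ a ∈ A.maxIdeal, mkQuot I hI hle a = x)
    ⟨0, Ideal.zero_mem _, map_zero (mkQuot I hI hle).toAlgHom⟩ ?_ ?_ hx
  · intro n hn x hx
    obtain ⟨a, ha, rfl⟩ := exists_mem_part_of_quot hx
    exact ⟨a, mem_maxIdeal_of_part hn ha, rfl⟩
  · rintro x y ⟨a, ha, rfl⟩ ⟨b, hb, rfl⟩
    exact ⟨a + b, Ideal.add_mem _ ha hb, map_add (mkQuot I hI hle).toAlgHom a b⟩

theorem firstOrder_isSquareZero : A.firstOrder.IsSquareZero := by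
  intro x hx y hy
  obtain ⟨a, ha, rfl⟩ := exists_mem_maxIdeal_of_quot (mem_aug_iff.1 hx)
  obtain ⟨b, hb, rfl⟩ := exists_mem_maxIdeal_of_quot (mem_aug_iff.1 hy)
  have h : A.toFirstOrder (a * b) = A.toFirstOrder 0 := by
    rw [toFirstOrder_eq_iff, sub_zero, pow_two]
    exact Ideal.mul_mem_mul ha hb
  rw [map_mul, map_zero] at h
  exact h

end WeightedAlgebra

open WeightedAlgebra

/-! ### Morphisms of weighted algebras, controlled to first order. -/

section

variable {A B : WeightedAlgebra k}

theorem WHom.ext {f g : WHom A B} (h : ∀ a, f a = g a) : f = g := by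
  obtain ⟨f, _⟩ := f
  obtain ⟨g, _⟩ := g
  obtain rfl : f = g := AlgHom.ext h
  rfl

theorem WHom.ext_part {f g : WHom A B} (h : ∀ n, 0 < n → ∀ a ∈ A.part n, f a = g a) : f = g := by
  refine WHom.ext fun a => ?_
  induction a using part_induction with
  | zero => simp
  | add a b ha hb => simp [ha, hb]
  | mem n a ha =>
    rcases Nat.eq_zero_or_pos n with rfl | hn
    · obtain ⟨c, rfl⟩ := exists_algebraMap_of_mem_zero ha
      simp
    · exact h n hn a ha

/-- The identity morphism. -/
def WHom.id (A : WeightedAlgebra k) : WHom A A where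
  toAlgHom := AlgHom.id k A
  map_mem _ _ ha := ha

/-- An endomorphism that is the identity modulo `m²` is bijective. -/
theorem WHom.bijective_of_toFirstOrder_comp {f : WHom A A}
    (h : A.toFirstOrder.comp f = A.toFirstOrder) : Function.Bijective f := by
  have h1 : ∀ a, f a - a ∈ A.maxIdeal ^ 2 := fun a =>
    toFirstOrder_eq_iff.1 (congrArg (fun g : WHom A A.firstOrder => g a) h)
  let δ : A →ₗ[k] A := f.toAlgHom.toLinearMap - LinearMap.id
  have hδ : ∀ a, δ a = f a - a := fun a => rfl
  -- By the twisted Leibniz rule `δ (x * y) = δ x * f y + x * δ y`, the map `δ` raises the `m`-adic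
  -- order. It preserves weights, so it is locally nilpotent and `f = 1 + δ` is unipotent.
  have h2 : ∀ j, ∀ a ∈ A.maxIdeal ^ (j + 1), δ a ∈ A.maxIdeal ^ (j + 2) := by
    intro j
    induction j with
    | zero => exact fun a _ => h1 a
    | succ j ih =>
      intro a ha
      rw [pow_succ] at ha
      induction ha using Submodule.mul_induction_on' with
      | add x _ y _ hx hy => rw [map_add]; exact Ideal.add_mem _ hx hy
      | mem_mul_mem x hx y hy =>
        have e : δ (x * y) = δ x * f y + x * δ y := by
          simp only [hδ, map_mul]; ring
        rw [e]
        refine Ideal.add_mem _ ?_ ?_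
        · rw [pow_succ]
          exact Ideal.mul_mem_mul (ih x hx) (map_mem_maxIdeal f hy)
        · rw [show j + 1 + 2 = (j + 1) + 2 from rfl, pow_add]
          exact Ideal.mul_mem_mul hx (h1 y)
  have h3 : ∀ n, ∀ a ∈ A.part n, δ a ∈ A.part n := fun n a ha =>
    Submodule.sub_mem _ (f.map_mem n a ha) ha
  have h4 : ∀ n j, ∀ a ∈ A.part n, (δ ^ j) a ∈ A.part n ∧
      (0 < j → (δ ^ j) a ∈ A.maxIdeal ^ (j + 1)) := by
    intro n j
    induction j with
    | zero => exact fun a ha => ⟨ha, fun h => absurd h (lt_irrefl _)⟩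
    | succ j ih =>
      intro a ha
      obtain ⟨i1, i2⟩ := ih a ha
      rw [pow_succ', Module.End.mul_apply]
      refine ⟨h3 n _ i1, fun _ => ?_⟩
      rcases Nat.eq_zero_or_pos j with rfl | hj
      · exact h1 _
      · exact h2 _ _ (i2 hj)
  have h5 : ∀ a, ∃ j, (δ ^ j) a = 0 := by
    intro a
    induction a using part_induction with
    | zero => exact ⟨0, by simp⟩
    | add a b ha hb =>
      obtain ⟨i, hi⟩ := ha
      obtain ⟨j, hj⟩ := hb
      refine ⟨i + j, ?_⟩
      rw [map_add, pow_add, Module.End.mul_apply, Module.End.mul_apply, hj, map_zero, add_zero,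
        ← Module.End.mul_apply, ← pow_add, add_comm, pow_add, Module.End.mul_apply, hi, map_zero]
    | mem n a ha =>
      refine ⟨n + 1, ?_⟩
      obtain ⟨i1, i2⟩ := h4 n (n + 1) a ha
      rw [← proj_of_mem i1]
      exact proj_eq_zero_of_mem_pow (by omega) (i2 n.succ_pos)
  constructor
  · refine (injective_iff_map_eq_zero f.toAlgHom).2 fun a ha => ?_
    have h6 : δ a = -a := by rw [hδ, show f a = 0 from ha, zero_sub]
    have h7 : ∀ j, (δ ^ j) a = (-1) ^ j * a := by
      intro j
      induction j with
      | zero => simp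
      | succ j ih =>
        have : δ ((-1) ^ j * a) = (-1) ^ j * δ a := by
          rcases neg_one_pow_eq_or A j with h | h <;> simp [h]
        rw [pow_succ', Module.End.mul_apply, ih, this, h6]; ring
    obtain ⟨j, hj⟩ := h5 a
    rw [h7] at hj
    rcases neg_one_pow_eq_or A j with h | h <;> simpa [h] using hj
  · intro a
    obtain ⟨j, hj⟩ := h5 a
    induction j generalizing a with
    | zero => exact ⟨0, by simpa using hj.symm⟩
    | succ j ih =>
      rw [pow_succ, Module.End.mul_apply] at hj
      obtain ⟨b, hb⟩ := ih _ hj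
      -- Here `f b = δ a = f a - a`, by induction on the order of nilpotency.
      exact ⟨a - b, by rw [map_sub, hb, hδ]; abel⟩

end

variable {A B C Z : WeightedAlgebra k}

theorem WeightedAlgebra.exists_augmentation (A : WeightedAlgebra k) :
    ∃ ε : A →ₗ[k] k, ε 1 = 1 ∧ ∀ a ∈ A.maxIdeal, ε a = 0 := by
  obtain ⟨ε, hε⟩ := LinearMap.exists_leftInverse_of_injective (Algebra.linearMap k A)
    (LinearMap.ker_eq_bot.2 (algebraMap k A).injective)
  refine ⟨ε ∘ₗ A.proj 0, ?_, fun a ha => ?_⟩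
  · have h1 : ε 1 = 1 := by simpa using LinearMap.congr_fun hε 1
    rw [LinearMap.comp_apply, proj_of_mem SetLike.GradedOne.one_mem, h1]
  · rw [LinearMap.comp_apply, mem_maxIdeal_iff.1 ha, map_zero]

/-- A linear map to a square zero algebra that preserves `1` and the weights and kills the square of
the augmentation ideal is a morphism. -/
def WHom.ofLinear (hZ : Z.IsSquareZero) (f : A →ₗ[k] Z) (h1 : f 1 = 1)
    (hf : ∀ n, ∀ a ∈ A.part n, f a ∈ Z.part n) (h2 : ∀ a ∈ A.maxIdeal ^ 2, f a = 0) :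
    WHom A Z where
  toAlgHom := AlgHom.ofLinearMap f h1 fun a b => by
    have hm : ∀ a ∈ A.maxIdeal, f a ∈ Z.maxIdeal := fun a ha =>
      maxIdeal_induction (P := fun a => f a ∈ Z.maxIdeal) (by simp)
        (fun n hn a ha => mem_maxIdeal_of_part hn (hf n a ha))
        (fun a b ha hb => by rw [map_add]; exact Ideal.add_mem _ ha hb) ha
    obtain ⟨c, a, ha, rfl⟩ := exists_add_mem_maxIdeal a
    obtain ⟨c', b, hb, rfl⟩ := exists_add_mem_maxIdeal b
    have h3 : f (a * b) = 0 := h2 _ (by rw [pow_two]; exact Ideal.mul_mem_mul ha hb)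
    have h4 := hZ.mul_eq_zero (hm a ha) (hm b hb)
    simp only [Algebra.algebraMap_eq_smul_one, add_mul, mul_add, smul_mul_assoc, one_mul,
      mul_smul_comm, mul_one, map_add, map_smul, h1, h3, h4]
  map_mem := hf

theorem WHom.comp_apply (g : WHom B C) (f : WHom A B) (a : A) : g.comp f a = g (f a) := rfl

theorem WHom.comp_assoc {W : WeightedAlgebra k} (h : WHom C W) (g : WHom B C) (f : WHom A B) :
    (h.comp g).comp f = h.comp (g.comp f) := rfl

theorem WeightedAlgebra.toFirstOrder_comp_congr (g : WHom A B) {a b : A}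
    (h : A.toFirstOrder a = A.toFirstOrder b) : B.toFirstOrder (g a) = B.toFirstOrder (g b) := by
  rw [toFirstOrder_eq_iff] at h ⊢
  rw [← map_sub]
  exact map_maxIdeal_sq_mem g h

theorem WeightedAlgebra.IsSquareZero.map_congr (hZ : Z.IsSquareZero) (g : WHom A Z) {a b : A}
    (h : A.toFirstOrder a = A.toFirstOrder b) : g a = g b := by
  rw [toFirstOrder_eq_iff] at h
  rw [← sub_eq_zero, ← map_sub]
  exact hZ.map_eq_zero g h

theorem WeightedDGCA.part_induction {R : WeightedDGCA.{u, v} k} {P : R → Prop} (zero : P 0)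
    (mem : ∀ n w, ∀ a ∈ R.part (n, w), P a) (add : ∀ a b, P a → P b → P (a + b)) (a : R) : P a := by
  have ha : a ∈ ⨆ p, R.part p := by rw [R.internal.submodule_iSup_eq_top]; trivial
  induction ha using Submodule.iSup_induction' with
  | zero => exact zero
  | add b c _ _ hb hc => exact add b c hb hc
  | mem i b hb => exact mem i.1 i.2 b hb

/-! ### Functoriality of families, and versality as a lifting property. -/

namespace Deformation

variable {R : WeightedDGCA.{u, v} k}

theorem ext_e {E F : Deformation R B} (h : ∀ n w, ∀ r ∈ R.part (n, w), E.e r = F.e r) :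
    E = F := by
  have : E.e = F.e := by
    ext r
    induction r using WeightedDGCA.part_induction with
    | zero => simp
    | mem n w r hr => exact h n w r hr
    | add a b ha hb => rw [map_add, map_add, ha, hb]
  cases E
  cases F
  subst this
  rfl

theorem baseMap_comp (g : WHom B C) (f : WHom A B) (x : A ⊗[k] R) :
    baseMap R (g.comp f) x = baseMap R g (baseMap R f x) := by
  induction x using TensorProduct.induction_on with
  | zero => simp
  | add x y hx hy => simp only [map_add, hx, hy]
  | tmul a r => simp [WHom.comp_apply]

theorem map_map (E : Deformation R A) (f : WHom A B) (g : WHom B C) :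
    (E.map f).map g = E.map (g.comp f) :=
  ext_e fun _ _ r _ => (baseMap_comp g f (E.e r)).symm

theorem map_id (E : Deformation R A) : E.map (WHom.id A) = E :=
  ext_e fun n w r _ => by
    change baseMap R (WHom.id A) (E.e r) = E.e r
    induction E.e r using TensorProduct.induction_on with
    | zero => simp
    | add x y hx hy => simp only [map_add, hx, hy]
    | tmul a r => rw [baseMap_tmul]; rfl

theorem IsVersal.exists_lift {E : Deformation R A} (hE : E.IsVersal) {B' : WeightedAlgebra k}
    (p : WHom B B') (hp : Function.Surjective p) (hB' : B'.IsSquareZero) (f' : WHom A B')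
    (G : Deformation R B) (h : IsIso (E.map f') (G.map p)) :
    ∃ f : WHom A B, p.comp f = f' ∧ IsIso (E.map f) G := by
  obtain ⟨f, hf, hf'⟩ := hE B B' p hp hB' f' (Quotient.mk _ G) (Quotient.sound h)
  exact ⟨f, hf, Quotient.exact hf'⟩

theorem isVersal_of_exists_lift {E : Deformation R A}
    (h : ∀ (B B' : WeightedAlgebra k) (p : WHom B B'), Function.Surjective p →
      B'.IsSquareZero → ∀ (f' : WHom A B') (G : Deformation R B),
      IsIso (E.map f') (G.map p) → ∃ f : WHom A B, p.comp f = f' ∧ IsIso (E.map f) G) :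
    E.IsVersal := by
  intro B B' p hp hB' f' m hm
  induction m using Quotient.inductionOn with
  | _ G =>
    obtain ⟨f, hf, hf'⟩ := h B B' p hp hB' f' G (Quotient.exact hm)
    exact ⟨f, hf, Quotient.sound hf'⟩

theorem classify_eq_iff {E : Deformation R A} {f g : WHom A B} :
    E.classify B f = E.classify B g ↔ IsIso (E.map f) (E.map g) :=
  ⟨fun h => Quotient.exact h, fun h => Quotient.sound h⟩

/-- Over `K = B / m`, a copy of `k`, the space `m_K ⊗ R` is zero and all families coincide.
Smoothness for `B → K` then lifts the augmentation of `A` to a morphism that induces `G`. -/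
theorem IsVersal.exists_isIso {E : Deformation R A} (hE : E.IsVersal) (G : Deformation R B) :
    ∃ f : WHom A B, IsIso (E.map f) G := by
  let K := B.quot B.maxIdeal maxIdeal_isHomogeneous le_rfl
  have hK : ∀ n, 0 < n → ∀ x ∈ K.part n, x = 0 := by
    intro n hn x hx
    obtain ⟨b, hb, rfl⟩ := exists_mem_part_of_quot hx
    rw [← map_zero (mkQuot B.maxIdeal maxIdeal_isHomogeneous le_rfl).toAlgHom]
    refine mkQuot_eq_iff.2 ?_
    rw [sub_zero]
    exact mem_maxIdeal_of_part hn hb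
  have hK' : ∀ x ∈ K.maxIdeal, x = 0 := fun x hx =>
    maxIdeal_induction (P := fun x => x ∈ (⊥ : Submodule k K)) (Submodule.zero_mem _) hK
      (fun a b ha hb => Submodule.add_mem _ ha hb) hx
  have hlow : ∀ n w, ∀ x ∈ lowPart R K n w, x = 0 := by
    intro n w x hx
    induction hx using Submodule.span_induction with
    | zero => rfl
    | add x y _ _ hx hy => rw [hx, hy, add_zero]
    | smul a x _ hx => rw [hx, smul_zero]
    | mem x hx =>
      obtain ⟨i, j, hi, -, b, hb, r, -, rfl⟩ := hx
      rw [hK i hi b hb, TensorProduct.zero_tmul]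
  have hsq : K.IsSquareZero := fun x hx y _ => by
    rw [hK' x (mem_aug_iff.1 hx), zero_mul]
  obtain ⟨ε, hε, hε'⟩ := A.exists_augmentation
  let f' : WHom A K := WHom.ofLinear hsq (Algebra.linearMap k K ∘ₗ ε)
    (by rw [LinearMap.comp_apply, hε]; simp)
    (by
      intro n a ha
      rcases Nat.eq_zero_or_pos n with rfl | hn
      · exact algebraMap_mem _
      · rw [LinearMap.comp_apply, hε' a (mem_maxIdeal_of_part hn ha)]
        simp)
    (by
      intro a ha
      rw [LinearMap.comp_apply, hε' a (Ideal.pow_le_self two_ne_zero ha)]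
      simp)
  obtain ⟨f, -, hf⟩ := hE.exists_lift (mkQuot B.maxIdeal maxIdeal_isHomogeneous le_rfl)
    (mkQuot_surjective _ _ _) hsq f' G (by
      have : E.map f' = G.map (mkQuot B.maxIdeal maxIdeal_isHomogeneous le_rfl) :=
        ext_e fun n w r hr => by
          rw [hlow _ _ _ (mem_lowPart _ n w r hr), hlow _ _ _ (mem_lowPart _ n w r hr)]
      rw [this]
      exact IsIso.refl _)
  exact ⟨f, hf⟩

/-! ### Isomorphisms over a square zero base -/

/-- The subspace `m_Z ⊗ R`. -/
def augPart (R : WeightedDGCA.{u, v} k) (Z : WeightedAlgebra k) : Submodule k (Z ⊗[k] R) :=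
  Submodule.span k {x | ∃ z ∈ Z.maxIdeal, ∃ r : R, x = z ⊗ₜ[k] r}

theorem lowPart_le_augPart (n w : ℕ) : lowPart R Z n w ≤ augPart R Z := by
  refine Submodule.span_mono ?_
  rintro x ⟨i, j, hi, -, b, hb, r, -, rfl⟩
  exact ⟨b, mem_maxIdeal_of_part hi hb, r, rfl⟩

theorem augPart_mul_eq_zero (hZ : Z.IsSquareZero) {x y : Z ⊗[k] R} (hx : x ∈ augPart R Z)
    (hy : y ∈ augPart R Z) : x * y = 0 := by
  induction hx using Submodule.span_induction with
  | zero => simp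
  | add x₁ x₂ _ _ h₁ h₂ => rw [add_mul, h₁, h₂, add_zero]
  | smul a x₁ _ h₁ => rw [smul_mul_assoc, h₁, smul_zero]
  | mem x hx =>
    induction hy using Submodule.span_induction with
    | zero => simp
    | add x₁ x₂ _ _ h₁ h₂ => rw [mul_add, h₁, h₂, add_zero]
    | smul a x₁ _ h₁ => rw [mul_smul_comm, h₁, smul_zero]
    | mem y hy =>
      obtain ⟨z, hz, r, rfl⟩ := hx
      obtain ⟨z', hz', r', rfl⟩ := hy
      rw [Algebra.TensorProduct.tmul_mul_tmul, hZ.mul_eq_zero hz hz', TensorProduct.zero_tmul]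

/-- By `Z`-linearity the error on `z ⊗ r` is `z` times an element of `m_Z ⊗ R`, and `m_Z² = 0`. -/
theorem map_eq_self_of_mem_augPart (hZ : Z.IsSquareZero) (φ : Z ⊗[k] R →ₗ[Z] Z ⊗[k] R)
    (hφ : ∀ r : R, φ (1 ⊗ₜ r) - 1 ⊗ₜ r ∈ augPart R Z) {x : Z ⊗[k] R} (hx : x ∈ augPart R Z) :
    φ x = x := by
  induction hx using Submodule.span_induction with
  | zero => simp
  | add x₁ x₂ _ _ h₁ h₂ => rw [map_add, h₁, h₂]
  | smul a x₁ _ h₁ =>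
    have h := map_smul (φ.restrictScalars k) a x₁
    rw [LinearMap.restrictScalars_apply, LinearMap.restrictScalars_apply] at h
    rw [h, h₁]
  | mem x hx =>
    obtain ⟨z, hz, r, rfl⟩ := hx
    have h₁ : z ⊗ₜ[k] r = z • ((1 : Z) ⊗ₜ[k] r) := by simp [TensorProduct.smul_tmul']
    have h₂ : z • (φ (1 ⊗ₜ r) - 1 ⊗ₜ r) = 0 := by
      have h3 : z • (φ (1 ⊗ₜ r) - 1 ⊗ₜ r) = (z ⊗ₜ[k] (1 : R)) * (φ (1 ⊗ₜ r) - 1 ⊗ₜ r) := by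
        rw [Algebra.smul_def]; rfl
      rw [h3]
      exact augPart_mul_eq_zero hZ (Submodule.subset_span ⟨z, hz, 1, rfl⟩) (hφ r)
    rw [h₁, map_smul, ← sub_eq_zero, ← smul_sub, h₂]

theorem e_mem_augPart (E : Deformation R Z) (r : R) : E.e r ∈ augPart R Z := by
  induction r using WeightedDGCA.part_induction with
  | zero => simp
  | mem n w r hr => exact lowPart_le_augPart _ _ (E.mem_lowPart n w r hr)
  | add a b ha hb => rw [map_add]; exact Submodule.add_mem _ ha hb

theorem D_one_tmul (E : Deformation R Z) (r : R) : E.D (1 ⊗ₜ r) = 1 ⊗ₜ R.d r + E.e r := by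
  simp [D, totalD]

theorem D_of_mem_augPart (hZ : Z.IsSquareZero) (E : Deformation R Z) {x : Z ⊗[k] R}
    (hx : x ∈ augPart R Z) : E.D x = R.d.baseChange Z x := by
  -- Since `1 + e` is the identity on `m_Z ⊗ R`, the extension of `e` vanishes there.
  have h : ∀ φ : Z ⊗[k] R →ₗ[Z] Z ⊗[k] R, φ = LinearMap.id + E.e.liftBaseChange Z →
      φ x = x := by
    rintro φ rfl
    refine map_eq_self_of_mem_augPart hZ _ (fun r => ?_) hx
    simpa using e_mem_augPart E r
  have h' := h _ rfl
  simpa [D, totalD] using h'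

/-- A derivation with values in `m_Z ⊗ R`, whose commutator with `d` is the difference of two
deformations over a square zero base, provides an isomorphism. -/
theorem isIso_of_derivation (hZ : Z.IsSquareZero) {E F : Deformation R Z}
    (θ : R →ₗ[k] Z ⊗[k] R) (h₁ : ∀ n w, ∀ r ∈ R.part (n, w), θ r ∈ lowPart R Z n w)
    (h₂ : ∀ r s : R, θ (r * s) = θ r * 1 ⊗ₜ s + 1 ⊗ₜ r * θ s)
    (h₃ : ∀ r, E.e r - F.e r = R.d.baseChange Z (θ r) - θ (R.d r)) : IsIso E F := by
  have hθ : ∀ r, θ r ∈ augPart R Z := by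
    intro r
    induction r using WeightedDGCA.part_induction with
    | zero => simp
    | mem n w r hr => exact lowPart_le_augPart _ _ (h₁ n w r hr)
    | add a b ha hb => rw [map_add]; exact Submodule.add_mem _ ha hb
  -- `1 + η` is multiplicative because the extra term `η r * η s` vanishes. The choices `η = θ` and
  -- `η = -θ` give mutually inverse maps.
  have mk : ∀ η : R →ₗ[k] Z ⊗[k] R, (∀ r, η r ∈ augPart R Z) →
      (∀ r s : R, η (r * s) = η r * 1 ⊗ₜ s + 1 ⊗ₜ r * η s) →
      ∃ φ : Z ⊗[k] R →ₐ[Z] Z ⊗[k] R, ∀ r : R, φ (1 ⊗ₜ r) = 1 ⊗ₜ r + η r := by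
    intro η hη hη'
    have h1 : η 1 = 0 := by
      have := hη' 1 1
      rw [mul_one, ← Algebra.TensorProduct.one_def, mul_one, one_mul] at this
      simpa using this
    let ψ : R →ₐ[k] Z ⊗[k] R := AlgHom.ofLinearMap
      ((Algebra.TensorProduct.includeRight : R →ₐ[k] Z ⊗[k] R).toLinearMap + η)
      (by simp [h1, Algebra.TensorProduct.one_def])
      (by
        intro r s
        have h4 := augPart_mul_eq_zero hZ (hη r) (hη s)
        simp only [LinearMap.add_apply, AlgHom.toLinearMap_apply, map_mul, hη', mul_add, add_mul,
          h4, Algebra.TensorProduct.includeRight_apply]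
        abel)
    refine ⟨Algebra.TensorProduct.lift (Algebra.ofId Z (Z ⊗[k] R)) ψ
      (fun b r => Algebra.commutes b _), fun r => ?_⟩
    refine (Algebra.TensorProduct.lift_tmul _ _ _ _ _).trans ?_
    rw [map_one, one_mul]
    simp [ψ]
  obtain ⟨φ, hφ⟩ := mk θ hθ h₂
  obtain ⟨ψ, hψ⟩ := mk (-θ) (fun r => Submodule.neg_mem _ (hθ r)) (fun r s => by
    simp only [LinearMap.neg_apply, h₂, neg_add, neg_mul, mul_neg])
  have fφ : ∀ x ∈ augPart R Z, φ x = x := fun x hx =>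
    map_eq_self_of_mem_augPart hZ φ.toLinearMap (fun r => by simpa [hφ] using hθ r) hx
  have fψ : ∀ x ∈ augPart R Z, ψ x = x := fun x hx =>
    map_eq_self_of_mem_augPart hZ ψ.toLinearMap (fun r => by simpa [hψ] using hθ r) hx
  refine ⟨AlgEquiv.ofAlgHom φ ψ ?_ ?_, ?_, ?_⟩
  · ext r
    simp [hφ, hψ, fφ _ (hθ r)]
  · ext r
    simp [hφ, hψ, fψ _ (hθ r)]
  · intro n w r hr
    simpa [hφ] using h₁ n w r hr
  · intro x
    change φ (E.D x) = F.D (φ x)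
    have : ∀ r : R, φ (E.D (1 ⊗ₜ r)) = F.D (φ (1 ⊗ₜ r)) := by
      intro r
      rw [D_one_tmul, map_add, hφ, hφ, map_add, D_one_tmul, fφ _ (e_mem_augPart E r),
        D_of_mem_augPart hZ F (hθ r), sub_eq_iff_eq_add.1 (h₃ r)]
      abel
    have h : φ.toLinearMap ∘ₗ E.D = F.D ∘ₗ φ.toLinearMap := by
      ext r
      exact this r
    exact LinearMap.congr_fun h x

/-- Take `θ = φ - 1` on `R`. Multiplicativity of `φ` becomes the Leibniz rule, because products in
`m_Z ⊗ R` vanish. On `m_Z ⊗ R` the map `φ` is the identity and the deformed differential is `d`, so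
compatibility with the differentials becomes the commutator identity. -/
theorem IsIso.exists_derivation (hZ : Z.IsSquareZero) {E F : Deformation R Z} (h : IsIso E F) :
    ∃ θ : R →ₗ[k] Z ⊗[k] R, (∀ n w, ∀ r ∈ R.part (n, w), θ r ∈ lowPart R Z n w) ∧
      (∀ r s : R, θ (r * s) = θ r * 1 ⊗ₜ s + 1 ⊗ₜ r * θ s) ∧
      ∀ r, E.e r - F.e r = R.d.baseChange Z (θ r) - θ (R.d r) := by
  obtain ⟨φ, h₁, h₂⟩ := h
  let ι : R →ₐ[k] Z ⊗[k] R := Algebra.TensorProduct.includeRight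
  let θ : R →ₗ[k] Z ⊗[k] R :=
    ((φ.toLinearMap.restrictScalars k) ∘ₗ ι.toLinearMap) - ι.toLinearMap
  have hφ : ∀ r : R, φ (1 ⊗ₜ r) = 1 ⊗ₜ r + θ r := fun r => by simp [θ, ι]
  have hlow : ∀ n w, ∀ r ∈ R.part (n, w), θ r ∈ lowPart R Z n w := h₁
  have hθ : ∀ r, θ r ∈ augPart R Z := by
    intro r
    induction r using WeightedDGCA.part_induction with
    | zero => simp
    | mem n w r hr => exact lowPart_le_augPart _ _ (hlow n w r hr)
    | add a b ha hb => rw [map_add]; exact Submodule.add_mem _ ha hb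
  have fφ : ∀ x ∈ augPart R Z, φ x = x := fun x hx =>
    map_eq_self_of_mem_augPart hZ φ.toLinearMap (fun r => by simpa [hφ] using hθ r) hx
  refine ⟨θ, hlow, fun r s => ?_, fun r => ?_⟩
  · have h3 : (1 : Z) ⊗ₜ[k] (r * s) = 1 ⊗ₜ r * 1 ⊗ₜ s := by simp
    have h4 := hφ (r * s)
    rw [h3, map_mul, hφ, hφ, add_mul, mul_add, mul_add,
      augPart_mul_eq_zero hZ (hθ r) (hθ s)] at h4
    have h5 := add_left_cancel ((add_assoc _ _ _).symm.trans h4)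
    rw [← h5, add_zero, add_comm]
  · have h3 := h₂ (1 ⊗ₜ r)
    rw [D_one_tmul, map_add, hφ, hφ, map_add, D_one_tmul, fφ _ (e_mem_augPart E r),
      D_of_mem_augPart hZ F (hθ r)] at h3
    rw [sub_eq_sub_iff_add_eq_add]
    have h4 : (1 : Z) ⊗ₜ[k] R.d r + (E.e r + θ (R.d r)) =
        1 ⊗ₜ[k] R.d r + (R.d.baseChange Z (θ r) + F.e r) := by
      rw [add_comm (E.e r), ← add_assoc, h3]; abel
    exact add_left_cancel h4

end Deformation

/-- Linear maps on a direct sum can be prescribed on the summands. -/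
theorem exists_linearMap_of_isInternal {ι V W : Type*} [DecidableEq ι] [AddCommGroup V]
    [Module k V] [AddCommGroup W] [Module k W] (P : ι → Submodule k V)
    (hP : DirectSum.IsInternal P) (f : ι → V →ₗ[k] W) :
    ∃ F : V →ₗ[k] W, ∀ i, ∀ v ∈ P i, F v = f i v := by
  let _ := hP.chooseDecomposition
  refine ⟨DirectSum.toModule k ι W (fun i => f i ∘ₗ (P i).subtype) ∘ₗ
    (DirectSum.decomposeLinearEquiv P).toLinearMap, fun i v hv => ?_⟩
  rw [LinearMap.comp_apply, LinearEquiv.coe_coe, DirectSum.decomposeLinearEquiv_apply,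
    DirectSum.decompose_of_mem P hv]
  exact DirectSum.toModule_lof k i _

/-! ### Tangent vectors as morphisms to the dual numbers. -/

theorem mem_dual_part {i : ℕ} {hi : 0 < i} {n : ℕ} {x : dual k i hi} :
    x ∈ (dual k i hi).part n ↔
      (n ≠ 0 → TrivSqZeroExt.fst (x : DualNumber k) = 0) ∧
        (n ≠ i → TrivSqZeroExt.snd (x : DualNumber k) = 0) := Iff.rfl

/-- The coefficient of `ε`. -/
def dualSnd (k : Type u) [Field k] (i : ℕ) (hi : 0 < i) : dual k i hi →ₗ[k] k :=
  TrivSqZeroExt.sndHom k k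

theorem dual_ext_part {i : ℕ} {hi : 0 < i} {n : ℕ} (hn : 0 < n) {x y : dual k i hi}
    (hx : x ∈ (dual k i hi).part n) (hy : y ∈ (dual k i hi).part n)
    (h : dualSnd k i hi x = dualSnd k i hi y) : x = y :=
  TrivSqZeroExt.ext (((mem_dual_part.1 hx).1 hn.ne').trans ((mem_dual_part.1 hy).1 hn.ne').symm) h

theorem dual_isSquareZero (i : ℕ) (hi : 0 < i) : (dual k i hi).IsSquareZero := by
  have h : ∀ x ∈ (dual k i hi).aug, TrivSqZeroExt.fst (x : DualNumber k) = 0 := by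
    have : (dual k i hi).aug ≤ LinearMap.ker (TrivSqZeroExt.fstHom k k k).toLinearMap :=
      iSup_le fun n x hx => (mem_dual_part.1 hx).1 n.succ_ne_zero
    exact fun x hx => this hx
  intro x hx y hy
  refine TrivSqZeroExt.ext ?_ ?_
  · exact (TrivSqZeroExt.fst_mul (x : DualNumber k) y).trans (by rw [h x hx, zero_mul]; rfl)
  · refine (TrivSqZeroExt.snd_mul (x : DualNumber k) y).trans ?_
    rw [h x hx, h y hy]
    simp
    rfl

/-- A tangent vector of weight `i`, given by a linear form on `m / m²`. -/
theorem exists_whom_dual (i : ℕ) (hi : 0 < i) (τ : A →ₗ[k] k)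
    (hτ : ∀ a ∈ A.maxIdeal ^ 2, τ a = 0) :
    ∃ t : WHom A (dual k i hi), ∀ a, dualSnd k i hi (t a) = τ (A.proj i a) := by
  obtain ⟨ε, hε, hε'⟩ := A.exists_augmentation
  let f : A →ₗ[k] DualNumber k :=
    (TrivSqZeroExt.inlAlgHom k k k).toLinearMap ∘ₗ ε +
      TrivSqZeroExt.inrHom k k ∘ₗ τ ∘ₗ A.proj i
  have hf : ∀ a, f a = TrivSqZeroExt.inl (ε a) + TrivSqZeroExt.inr (τ (A.proj i a)) :=
    fun a => rfl
  refine ⟨WHom.ofLinear (dual_isSquareZero i hi) f ?_ ?_ ?_, fun a => ?_⟩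
  · change f 1 = 1
    rw [hf, hε, proj_of_ne hi.ne SetLike.GradedOne.one_mem]
    simp
  · intro n a ha
    refine mem_dual_part.2 ?_
    change (n ≠ 0 → TrivSqZeroExt.fst (f a : DualNumber k) = 0) ∧
      (n ≠ i → TrivSqZeroExt.snd (f a : DualNumber k) = 0)
    generalize hx : f a = x
    rw [hf] at hx
    subst hx
    constructor
    · intro hn
      rw [hε' a (mem_maxIdeal_of_part (Nat.pos_of_ne_zero hn) ha)]
      simp
    · intro hn
      rw [proj_of_ne hn ha]
      simp
  · intro a ha
    change f a = 0
    rw [hf, hε' a (Ideal.pow_le_self two_ne_zero ha),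
      hτ _ (proj_mem_of_isHomogeneous maxIdeal_sq_isHomogeneous i ha)]
    simp
  · change TrivSqZeroExt.snd (f a) = _
    rw [hf]
    simp

/-- An endomorphism that acts trivially on tangent vectors is the identity modulo `m²`. -/
theorem toFirstOrder_comp_of_dual {f : WHom A A}
    (h : ∀ i (hi : 0 < i) (t : WHom A (dual k i hi)), t.comp f = t) :
    A.toFirstOrder.comp f = A.toFirstOrder := by
  refine WHom.ext_part fun n hn a ha => ?_
  rw [WHom.comp_apply, toFirstOrder_eq_iff]
  by_contra hne
  -- If `f a - a` were not in `m²`, some linear form killing `m²` would detect it, and its component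
  -- of weight `n` would be a tangent vector moved by `f`.
  obtain ⟨τ, hτ, hτ'⟩ := Submodule.exists_le_ker_of_notMem
    (p := (A.maxIdeal ^ 2).restrictScalars k) hne
  obtain ⟨t, ht⟩ := exists_whom_dual n hn τ fun a ha => hτ' ha
  apply hτ
  have h1 := ht (f a)
  rw [← WHom.comp_apply, h n hn t, ht, proj_of_mem ha, proj_of_mem (f.map_mem n a ha)] at h1
  rw [map_sub, h1, sub_self]

/-! ### Uniqueness of miniversal families. -/

namespace Deformation

variable {R : WeightedDGCA.{u, v} k}

/-- For every tangent vector `t`, the families induced by `t ∘ f` and `t` are isomorphic, so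
injectivity of the Kodaira-Spencer map gives `t ∘ f = t`. -/
theorem IsMiniversal.toFirstOrder_comp {F : Deformation R B} (hF : F.IsMiniversal)
    {f : WHom B B} (h : IsIso (F.map f) F) : B.toFirstOrder.comp f = B.toFirstOrder := by
  refine toFirstOrder_comp_of_dual fun i hi t => (hF.2 i hi).1 ?_
  rw [classify_eq_iff, ← map_map]
  exact h.map t

/-- By versality each family induces the other. Both composites preserve a miniversal family, so
they are the identity modulo `m²` and hence bijective. -/
theorem IsMiniversal.familyIso {F : Deformation R A} {G : Deformation R B}
    (hF : F.IsMiniversal) (hG : G.IsMiniversal) : F.FamilyIso G := by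
  obtain ⟨f, hf⟩ := hF.1.exists_isIso G
  obtain ⟨g, hg⟩ := hG.1.exists_isIso F
  have h1 : Function.Bijective (g.comp f) := WHom.bijective_of_toFirstOrder_comp
    (hF.toFirstOrder_comp (by rw [← map_map]; exact (hf.map g).trans hg))
  have h2 : Function.Bijective (f.comp g) := WHom.bijective_of_toFirstOrder_comp
    (hG.toFirstOrder_comp (by rw [← map_map]; exact (hg.map f).trans hf))
  refine ⟨f, ⟨fun a b hab => h1.1 ?_, fun b => ?_⟩, hf⟩
  · rw [WHom.comp_apply, WHom.comp_apply, hab]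
  · obtain ⟨a, ha⟩ := h2.2 b
    exact ⟨g a, ha⟩

end Deformation

/-! ### Morphisms out of tensor products and polynomial algebras -/

/-- The inclusion of the second factor. -/
def tensorInr (B C : WeightedAlgebra k) : WHom C (tensor B C) where
  toAlgHom := (Algebra.TensorProduct.includeRight : C →ₐ[k] B ⊗[k] C)
  map_mem n c hc := by
    change (1 : B) ⊗ₜ[k] c ∈ tensorPart B C n
    exact Submodule.subset_span ⟨0, n, zero_add n, 1, SetLike.GradedOne.one_mem, c, hc, rfl⟩

/-- The morphism from a tensor product given by morphisms from the factors. -/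
def WHom.tensorLift (f : WHom B Z) (g : WHom C Z) : WHom (tensor B C) Z where
  toAlgHom := (Algebra.TensorProduct.productMap f.toAlgHom g.toAlgHom : B ⊗[k] C →ₐ[k] Z)
  map_mem n x hx := by
    have key : ∀ x : B ⊗[k] C, x ∈ tensorPart B C n →
        Algebra.TensorProduct.productMap f.toAlgHom g.toAlgHom x ∈ Z.part n := by
      intro x hx
      induction hx using Submodule.span_induction with
      | zero => rw [map_zero]; exact Submodule.zero_mem _
      | add x y _ _ hx hy => rw [map_add]; exact Submodule.add_mem _ hx hy
      | smul a x _ hx => rw [map_smul]; exact Submodule.smul_mem _ _ hx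
      | mem x hx =>
        obtain ⟨i, j, rfl, b, hb, c, hc, rfl⟩ := hx
        rw [Algebra.TensorProduct.productMap_apply_tmul]
        exact SetLike.GradedMul.mul_mem (f.map_mem i b hb) (g.map_mem j c hc)
    exact key x hx

theorem WHom.tensorLift_inl (f : WHom B Z) (g : WHom C Z) (b : B) :
    f.tensorLift g (tensorInl B C b) = f b :=
  Algebra.TensorProduct.productMap_left_apply f.toAlgHom g.toAlgHom b

theorem WHom.tensorLift_inr (f : WHom B Z) (g : WHom C Z) (c : C) :
    f.tensorLift g (tensorInr B C c) = g c :=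
  Algebra.TensorProduct.productMap_right_apply f.toAlgHom g.toAlgHom c

theorem WHom.tensor_ext {f g : WHom (tensor B C) Z}
    (h₁ : ∀ b, f (tensorInl B C b) = g (tensorInl B C b))
    (h₂ : ∀ c, f (tensorInr B C c) = g (tensorInr B C c)) : f = g := by
  have h : f.toAlgHom = g.toAlgHom :=
    Algebra.TensorProduct.ext (A := B) (B := C) (AlgHom.ext h₁) (AlgHom.ext h₂)
  exact WHom.ext fun a => congrArg (fun φ => φ a) h

section Poly

variable {σ : Type u} {c : σ → ℕ} {hc : ∀ s, 0 < c s}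

variable (hc) in
/-- The generator of a weighted polynomial algebra. -/
def polyVar (s : σ) : poly k c hc := (MvPolynomial.X s : MvPolynomial σ k)

theorem polyVar_mem (s : σ) : polyVar hc s ∈ (poly k c hc).part (c s) :=
  MvPolynomial.isWeightedHomogeneous_X k c s

variable (hc) in
/-- The morphism from a polynomial algebra given by the images of the generators. -/
def polyLift (l : σ → A) (hl : ∀ s, l s ∈ A.part (c s)) : WHom (poly k c hc) A where
  toAlgHom := (MvPolynomial.aeval l : MvPolynomial σ k →ₐ[k] A)
  map_mem n p hp := by
    have key : ∀ p : MvPolynomial σ k, MvPolynomial.IsWeightedHomogeneous c p n →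
        MvPolynomial.aeval l p ∈ A.part n := by
      intro p hp
      rw [MvPolynomial.aeval_def, MvPolynomial.eval₂_eq]
      refine Submodule.sum_mem _ fun d hd => ?_
      rw [← Algebra.smul_def]
      refine Submodule.smul_mem _ _ ?_
      have h := hp (MvPolynomial.mem_support_iff.1 hd)
      rw [Finsupp.weight_apply, Finsupp.sum] at h
      rw [← h]
      exact SetLike.prod_pow_mem_graded A.part _ _ _ fun s _ => hl s
    exact key p hp

theorem polyLift_polyVar (l : σ → A) (hl : ∀ s, l s ∈ A.part (c s)) (s : σ) :
    polyLift hc l hl (polyVar hc s) = l s := MvPolynomial.aeval_X l s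

theorem WHom.poly_ext {f g : WHom (poly k c hc) A}
    (h : ∀ s, f (polyVar hc s) = g (polyVar hc s)) : f = g := by
  have h' : f.toAlgHom = g.toAlgHom := MvPolynomial.algHom_ext (σ := σ) (R := k) h
  exact WHom.ext fun a => congrArg (fun φ => φ a) h'

end Poly

/-- Coordinates on the quotients of a weighted algebra by subspaces `N i`, in each weight `i`. -/
theorem exists_coordinates (N : ℕ → Submodule k A) (h0 : N 0 = ⊤)
    (hN : ∀ i n, n ≠ i → A.part n ≤ N i) :
    ∃ (σ : Type u) (c : σ → ℕ) (hc : ∀ s, 0 < c s) (l : σ → A)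
      (q : ℕ → A →ₗ[k] poly k c hc),
      (∀ s, l s ∈ A.part (c s)) ∧ (∀ i, ∀ a ∈ N i, q i a = 0) ∧
      (∀ i a, q i a ∈ (poly k c hc).part i) ∧
      (∀ i a, q i a ∈ Submodule.span k (Set.range (polyVar hc))) ∧
      (∀ s, q (c s) (l s) = polyVar hc s) ∧
      ∀ i a, ∀ ψ : poly k c hc →ₗ[k] A, (∀ s, ψ (polyVar hc s) = l s) →
        a - ψ (q i a) ∈ N i := by
  -- `A ⧸ N i` is a quotient of the component of weight `i`, so its basis lifts to homogeneous
  -- elements `l s`. The map `q i` writes the coordinates modulo `N i` as a linear form in the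
  -- variables. The condition `N 0 = ⊤` rules out variables of weight zero.
  let ι : ℕ → Type u := fun i => Module.Basis.ofVectorSpaceIndex k (A ⧸ N i)
  let b : ∀ i, Module.Basis (ι i) k (A ⧸ N i) := fun i => Module.Basis.ofVectorSpace k (A ⧸ N i)
  let c : (Σ i, ι i) → ℕ := Sigma.fst
  have hc : ∀ s, 0 < c s := by
    rintro ⟨i, s⟩
    rcases Nat.eq_zero_or_pos i with rfl | hi
    · have : Subsingleton (A ⧸ N 0) := Submodule.Quotient.subsingleton_iff.2 h0
      exact absurd (Subsingleton.elim _ _) ((b 0).ne_zero s)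
    · exact hi
  have hproj : ∀ i a, a - A.proj i a ∈ N i := by
    intro i a
    induction a using part_induction with
    | zero => simp
    | add a b ha hb => simpa [add_sub_add_comm] using Submodule.add_mem _ ha hb
    | mem n a ha =>
      by_cases h : n = i
      · subst h; simp [proj_of_mem ha]
      · rw [proj_of_ne h ha, sub_zero]; exact hN i n h ha
  have hl : ∀ s : Σ i, ι i, ∃ a ∈ A.part (c s), (N s.1).mkQ a = b s.1 s.2 := by
    rintro ⟨i, s⟩
    obtain ⟨a, ha⟩ := (N i).mkQ_surjective (b i s)
    refine ⟨A.proj i a, proj_mem i a, ?_⟩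
    rw [← ha, eq_comm, ← sub_eq_zero, ← map_sub]
    exact (Submodule.Quotient.mk_eq_zero _).2 (hproj i a)
  choose l hl hl' using hl
  let q : ∀ i, A →ₗ[k] poly k c hc := fun i =>
    Finsupp.linearCombination k (fun s : ι i => polyVar hc (⟨i, s⟩ : Σ i, ι i)) ∘ₗ
      (b i).repr.toLinearMap ∘ₗ (N i).mkQ
  have hq : ∀ i a, q i a = Finsupp.linearCombination k
    (fun s : ι i => polyVar hc (⟨i, s⟩ : Σ i, ι i)) ((b i).repr ((N i).mkQ a)) := fun _ _ => rfl
  refine ⟨_, c, hc, l, q, hl, ?_, ?_, ?_, ?_, ?_⟩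
  · intro i a ha
    rw [hq, (Submodule.Quotient.mk_eq_zero (N i)).2 ha |> fun h => (h : (N i).mkQ a = 0)]
    simp
  · intro i a
    rw [hq, Finsupp.linearCombination_apply]
    exact Submodule.sum_mem _ fun s _ => Submodule.smul_mem _ _ (polyVar_mem (hc := hc) _)
  · intro i a
    rw [hq, Finsupp.linearCombination_apply]
    exact Submodule.sum_mem _ fun s _ =>
      Submodule.smul_mem _ _ (Submodule.subset_span ⟨_, rfl⟩)
  · rintro ⟨i, s⟩
    rw [hq, hl' ⟨i, s⟩]
    change Finsupp.linearCombination k _ ((b i).repr (b i s)) = _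
    rw [(b i).repr_self, Finsupp.linearCombination_single, one_smul]
  · intro i a ψ hψ
    rw [← Submodule.Quotient.mk_eq_zero, ← Submodule.mkQ_apply, map_sub, sub_eq_zero, hq,
      ← LinearMap.comp_apply, Finsupp.apply_linearCombination]
    have : ((N i).mkQ ∘ₗ ψ) ∘ (fun s : ι i => polyVar hc (⟨i, s⟩ : Σ i, ι i)) = b i := by
      funext s
      simp only [Function.comp_apply, LinearMap.comp_apply, hψ]
      exact hl' ⟨i, s⟩
    rw [this, (b i).linearCombination_repr]

theorem WeightedAlgebra.exists_sum_proj (a : A) : ∃ S : Finset ℕ, a = ∑ n ∈ S, A.proj n a := by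
  classical
  exact ⟨_, (DirectSum.sum_support_decompose A.part a).symm⟩

theorem WHom.map_proj (f : WHom A B) (n : ℕ) (a : A) : f (A.proj n a) = B.proj n (f a) := by
  induction a using part_induction with
  | zero => simp
  | add a b ha hb => simp only [map_add, ha, hb]
  | mem m a ha =>
    by_cases h : m = n
    · subst h; rw [proj_of_mem ha, proj_of_mem (f.map_mem m a ha)]
    · rw [proj_of_ne h ha, proj_of_ne h (f.map_mem m a ha), map_zero]

/-- A morphism to a square zero algebra may be perturbed by a linear map that kills `k` and `m²`. -/
theorem WHom.exists_add (hZ : Z.IsSquareZero) (f : WHom A Z) (μ : A →ₗ[k] Z)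
    (hμ : ∀ n, ∀ a ∈ A.part n, μ a ∈ Z.part n) (h1 : μ 1 = 0)
    (h2 : ∀ a ∈ A.maxIdeal ^ 2, μ a = 0) : ∃ g : WHom A Z, ∀ a, g a = f a + μ a :=
  ⟨WHom.ofLinear hZ (f.toAlgHom.toLinearMap + μ) (by simp [h1])
    (fun n a ha => Submodule.add_mem _ (f.map_mem n a ha) (hμ n a ha))
    (fun a ha => by
      rw [LinearMap.add_apply, h2 a ha, add_zero]
      exact hZ.map_eq_zero f ha), fun a => rfl⟩

theorem eq_zero_of_forall_proj {W : Type*} [AddCommGroup W] [Module k W] {q : ℕ → A →ₗ[k] W}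
    {F : A →ₗ[k] W} (hF : ∀ n, ∀ a ∈ A.part n, F a = q n a) {a : A}
    (h : ∀ n, q n (A.proj n a) = 0) : F a = 0 := by
  obtain ⟨S, hS⟩ := exists_sum_proj a
  rw [hS, map_sum]
  exact Finset.sum_eq_zero fun n _ => by rw [hF n _ (proj_mem n a), h n]

/-! ### Versal families as products over a miniversal one. -/

namespace Deformation

variable {R : WeightedDGCA.{u, v} k}

/-- A versal family is the product of any miniversal family with a trivial family. -/
theorem IsVersal.exists_familyIso {E : Deformation R A} (hE : E.IsVersal) {F : Deformation R B}
    (hF : F.IsMiniversal) : ∃ (σ : Type u) (c : σ → ℕ) (hc : ∀ s, 0 < c s),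
      E.FamilyIso (F.prodTrivial (poly k c hc)) := by
  obtain ⟨f, hf⟩ := hE.exists_isIso F
  obtain ⟨g, hg⟩ := hF.1.exists_isIso E
  have hfg : ∀ b, B.toFirstOrder (f (g b)) = B.toFirstOrder b := fun b =>
    congrArg (fun t : WHom B B.firstOrder => t b)
      (hF.toFirstOrder_comp (f := f.comp g) (by rw [← map_map]; exact (hg.map f).trans hf))
  -- Modulo `m²`, this is the part of the cotangent space that comes from `B`. The polynomial
  -- variables are to span a complement.
  let T : Submodule k A :=
    LinearMap.range g.toAlgHom.toLinearMap ⊔ (A.maxIdeal ^ 2).restrictScalars k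
  obtain ⟨σ, c, hc, l, q, hl, hq0, hqm, hqs, hql, hqψ⟩ :=
    exists_coordinates (fun n => T.comap (A.proj n))
      (by
        rw [eq_top_iff]
        intro a _
        obtain ⟨x, hx⟩ := exists_algebraMap_of_mem_zero (proj_mem 0 a)
        exact Submodule.mem_sup_left ⟨algebraMap k B x, by rw [← hx]; simp⟩)
      (fun i n hn a ha => by
        rw [Submodule.mem_comap, proj_of_ne hn ha]
        exact Submodule.zero_mem _)
  obtain ⟨q', hq'⟩ := exists_linearMap_of_isInternal A.part A.internal q
  have hq'0 : ∀ a, (∀ n, A.proj n a ∈ T) → q' a = 0 := fun a ha =>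
    eq_zero_of_forall_proj hq' fun n => hq0 n _ (by
      rw [Submodule.mem_comap, proj_of_mem (proj_mem n a)]
      exact ha n)
  have hq'sq : ∀ a ∈ A.maxIdeal ^ 2, q' a = 0 := fun a ha => hq'0 a fun n =>
    Submodule.mem_sup_right (proj_mem_of_isHomogeneous maxIdeal_sq_isHomogeneous n ha)
  have hq'g : ∀ b, q' (g b) = 0 := fun b => hq'0 _ fun n => by
    rw [← WHom.map_proj]
    exact Submodule.mem_sup_left ⟨_, rfl⟩
  let P := tensor B (poly k c hc)
  let inl : WHom B P := tensorInl B (poly k c hc)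
  let inr : WHom (poly k c hc) P := tensorInr B (poly k c hc)
  -- To first order, `f'` is `f` plus the coordinates `q'` transversal to `T`. Since `q'` vanishes
  -- on `g(B)`, the composite `f' ∘ g` is the inclusion of `B` modulo `m²`. As `E` is induced from
  -- `F` by `g`, the family induced by `f'` is the reduction of the product family.
  obtain ⟨f', hf'⟩ := WHom.exists_add (firstOrder_isSquareZero (A := P))
    (P.toFirstOrder.comp (inl.comp f))
    (P.toFirstOrder.toAlgHom.toLinearMap ∘ₗ inr.toAlgHom.toLinearMap ∘ₗ q')
    (fun n a ha => P.toFirstOrder.map_mem n _ (inr.map_mem n _ (by rw [hq' n a ha]; exact hqm n a)))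
    (by
      have : q' 1 = 0 := by simpa using hq'g 1
      simp [this])
    (fun a ha => by simp [hq'sq a ha])
  replace hf' : ∀ a, f' a = P.toFirstOrder (inl (f a) + inr (q' a)) := fun a => by
    rw [hf', map_add]; rfl
  obtain ⟨φ, hφ, hφ'⟩ := hE.exists_lift P.toFirstOrder toFirstOrder_surjective
    firstOrder_isSquareZero f' (F.prodTrivial (poly k c hc)) (by
      have h1 : f'.comp g = P.toFirstOrder.comp inl := WHom.ext fun b => by
        rw [WHom.comp_apply, hf', hq'g, map_zero, add_zero]
        exact toFirstOrder_comp_congr inl (hfg b)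
      have h2 := (hg.map f').symm
      rw [map_map, h1] at h2
      rw [prodTrivial, map_map]
      exact h2)
  have hφa : ∀ a, P.toFirstOrder (φ a) = P.toFirstOrder (inl (f a) + inr (q' a)) := fun a => by
    rw [← hf', ← hφ]; rfl
  let ψ : WHom (poly k c hc) A := polyLift hc l hl
  -- Modulo `m²`, `φ (l s)` is `f (l s)` plus the variable. The correction `g (f (l s))` removes the
  -- first term, so `h` is inverse to `φ` to first order.
  let ψ' : WHom (poly k c hc) A := polyLift hc (fun s => l s - g (f (l s))) fun s =>
    Submodule.sub_mem _ (hl s) (g.map_mem _ _ (f.map_mem _ _ (hl s)))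
  let h : WHom P A := g.tensorLift ψ'
  have hψ' : ∀ x ∈ Submodule.span k (Set.range (polyVar hc)), ψ' x = ψ x - g (f (ψ x)) := by
    intro x hx
    induction hx using Submodule.span_induction with
    | zero => simp
    | add x y _ _ hx hy => simp only [map_add, hx, hy]; abel
    | smul a x _ hx => simp only [map_smul, hx, smul_sub]
    | mem x hx =>
      obtain ⟨s, rfl⟩ := hx
      rw [polyLift_polyVar, polyLift_polyVar]
  have b1 : Function.Bijective (φ.comp h) := by
    refine WHom.bijective_of_toFirstOrder_comp (WHom.tensor_ext (fun b => ?_) fun x => ?_)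
    · rw [WHom.comp_apply, WHom.comp_apply, WHom.tensorLift_inl, hφa, hq'g, map_zero, add_zero]
      exact toFirstOrder_comp_congr inl (hfg b)
    · have : P.toFirstOrder.comp (φ.comp ψ') = P.toFirstOrder.comp inr := by
        refine WHom.poly_ext fun s => ?_
        rw [WHom.comp_apply, WHom.comp_apply, WHom.comp_apply, polyLift_polyVar, hφa]
        rw [map_sub q', hq'g, hq' _ _ (hl s), hql, sub_zero, map_add, map_sub f.toAlgHom]
        have h3 : P.toFirstOrder (inl (f (l s) - f (g (f (l s))))) = P.toFirstOrder (inl 0) := by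
          refine toFirstOrder_comp_congr inl ?_
          rw [map_sub, hfg, sub_self, map_zero]
        rw [h3, map_zero, map_zero, zero_add]
      have h4 := congrArg (fun t : WHom (poly k c hc) P.firstOrder => t x) this
      rw [WHom.comp_apply, WHom.comp_apply, WHom.tensorLift_inr]
      exact h4
  have b2 : Function.Bijective (h.comp φ) := by
    refine WHom.bijective_of_toFirstOrder_comp (WHom.ext_part fun n hn a ha => ?_)
    have h1 : q' a = q n a := hq' n a ha
    have h2 : a - ψ (q n a) ∈ T := by
      have h3 := hqψ n a ψ.toAlgHom.toLinearMap (polyLift_polyVar l hl)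
      rwa [AlgHom.toLinearMap_apply, Submodule.mem_comap, proj_of_mem (Submodule.sub_mem _ ha
        (ψ.map_mem n _ (hqm n a)))] at h3
    obtain ⟨_, ⟨b, rfl⟩, m, hm, hbm⟩ := Submodule.mem_sup.1 h2
    replace hbm : g b + m = a - ψ (q n a) := hbm
    replace hm : m ∈ A.maxIdeal ^ 2 := hm
    have h3 : A.toFirstOrder (h (φ a)) = A.toFirstOrder (h (inl (f a) + inr (q' a))) :=
      toFirstOrder_comp_congr h (hφa a)
    rw [WHom.comp_apply, WHom.comp_apply, h3, map_add h.toAlgHom, WHom.tensorLift_inl,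
      WHom.tensorLift_inr, h1, hψ' _ (hqs n a), toFirstOrder_eq_iff]
    -- The left side is `g ∘ f - 1` applied to `a - ψ (q n a) = g b + m`. On `g b` it lies in `m²`
    -- because `f ∘ g` is the identity modulo `m²`.
    have h4 : g (f a) + (ψ (q n a) - g (f (ψ (q n a)))) - a =
        g (f (g b) - b) + g (f m) - m := by
      have h5 : g (f (a - ψ (q n a))) = g (f (g b + m)) := by rw [hbm]
      simp only [map_sub, map_add] at h5 ⊢
      linear_combination h5 + hbm
    rw [h4]
    refine Ideal.sub_mem _ (Ideal.add_mem _ ?_ ?_) hm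
    · exact map_maxIdeal_sq_mem g (toFirstOrder_eq_iff.1 (hfg b))
    · exact map_maxIdeal_sq_mem g (map_maxIdeal_sq_mem f hm)
  refine ⟨σ, c, hc, φ, ⟨fun a b hab => b2.1 ?_, fun x => ?_⟩, hφ'⟩
  · rw [WHom.comp_apply, WHom.comp_apply, hab]
  · obtain ⟨a, ha⟩ := b1.2 x
    exact ⟨h a, ha⟩

end Deformation

/-! ### Linear systems with vector-valued unknowns, and contraction of tensors. -/

/-- Solvability of a system of linear equations with values in a vector space. -/
theorem exists_linearMap_of_forall_mem {V A Y : Type*} [AddCommGroup V] [Module k V]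
    [AddCommGroup A] [Module k A] [AddCommGroup Y] [Module k Y] (G : Submodule k (V × A))
    (μ : A →ₗ[k] Y) (hμ : ∀ a, ((0, a) : V × A) ∈ G → μ a = 0) :
    ∃ T : V →ₗ[k] Y, ∀ p ∈ G, T p.1 = μ p.2 := by
  -- A pair `(v, a) ∈ G` stands for the equation `T v = μ a`. By `hμ`, `μ` descends to the image of
  -- `A` in the quotient. Modulo `G` one has `v = -a`, so minus an extension of the descended map
  -- solves the system.
  let j : A →ₗ[k] (V × A) ⧸ G := G.mkQ ∘ₗ LinearMap.inr k V A
  have hj : LinearMap.ker j ≤ LinearMap.ker μ := fun a ha =>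
    hμ a ((Submodule.Quotient.mk_eq_zero G).1 ha)
  obtain ⟨Φ, hΦ⟩ := LinearMap.exists_extend
    ((LinearMap.ker j).liftQ μ hj ∘ₗ j.quotKerEquivRange.symm.toLinearMap)
  have hΦ' : ∀ a, Φ (j a) = μ a := by
    intro a
    have h1 := LinearMap.congr_fun hΦ ⟨j a, LinearMap.mem_range_self j a⟩
    have h2 : j.quotKerEquivRange.symm ⟨j a, LinearMap.mem_range_self j a⟩ =
        (LinearMap.ker j).mkQ a := by
      rw [LinearEquiv.symm_apply_eq]
      rfl
    rw [LinearMap.comp_apply (f := (LinearMap.ker j).liftQ μ hj), LinearEquiv.coe_coe, h2] at h1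
    exact h1
  refine ⟨-(Φ ∘ₗ G.mkQ ∘ₗ LinearMap.inl k V A), fun p hp => ?_⟩
  have h3 : G.mkQ (p.1, 0) + j p.2 = 0 := by
    have : G.mkQ p = 0 := (Submodule.Quotient.mk_eq_zero G).2 hp
    rw [← this]
    change G.mkQ (p.1, 0) + G.mkQ (0, p.2) = _
    rw [← map_add]
    simp
  have h4 := congrArg Φ h3
  rw [map_add, hΦ', map_zero] at h4
  rw [LinearMap.neg_apply, neg_eq_iff_add_eq_zero]
  exact h4

theorem rTensor_lTensor {V V' Y Y' : Type*} [AddCommGroup V] [Module k V] [AddCommGroup V']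
    [Module k V'] [AddCommGroup Y] [Module k Y] [AddCommGroup Y'] [Module k Y'] (g : Y →ₗ[k] Y')
    (f : V →ₗ[k] V') (x : Y ⊗[k] V) :
    g.rTensor V' (f.lTensor Y x) = f.lTensor Y' (g.rTensor V x) := by
  rw [← LinearMap.comp_apply, ← LinearMap.comp_apply, LinearMap.rTensor_comp_lTensor,
    LinearMap.lTensor_comp_rTensor]

section Contract

variable {V Y Y' : Type*} [AddCommGroup V] [Module k V] [AddCommGroup Y] [Module k Y]
  [AddCommGroup Y'] [Module k Y']

variable (k V Y) in
/-- Contraction of `Y ⊗ V` with linear forms on `V`. -/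
def contract : Y ⊗[k] V →ₗ[k] Module.Dual k V →ₗ[k] Y :=
  TensorProduct.lift (LinearMap.mk₂ k
    (fun y v => (LinearMap.toSpanSingleton k Y y) ∘ₗ Module.Dual.eval k V v)
    (fun y y' v => by ext; simp) (fun c y v => by ext; exact smul_comm _ c y)
    (fun y v v' => by ext; simp [add_smul]) (fun c y v => by ext; simp [mul_smul]))

@[simp] theorem contract_tmul (y : Y) (v : V) (f : Module.Dual k V) :
    contract k V Y (y ⊗ₜ v) f = f v • y := by
  simp [contract]

theorem contract_lTensor (g : V →ₗ[k] V) (x : Y ⊗[k] V) (f : Module.Dual k V) :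
    contract k V Y (g.lTensor Y x) f = contract k V Y x (f ∘ₗ g) := by
  induction x using TensorProduct.induction_on with
  | zero => simp
  | add x y hx hy => simp only [map_add, LinearMap.add_apply, hx, hy]
  | tmul y v => simp

theorem contract_rTensor (g : Y →ₗ[k] Y') (x : Y ⊗[k] V) (f : Module.Dual k V) :
    contract k V Y' (g.rTensor V x) f = g (contract k V Y x f) := by
  induction x using TensorProduct.induction_on with
  | zero => simp
  | add x y hx hy => simp only [map_add, LinearMap.add_apply, hx, hy]
  | tmul y v => simp

/-- The coefficients of a tensor in a basis of `V` are its contractions with the coordinate forms.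
-/
theorem contract_injective : Function.Injective (contract k V Y) := by
  classical
  rw [injective_iff_map_eq_zero]
  intro x hx
  let b := Module.Basis.ofVectorSpace k V
  apply (TensorProduct.equivFinsuppOfBasisRight (M := Y) b).injective
  rw [map_zero]
  ext i
  have key : ∀ x : Y ⊗[k] V, TensorProduct.equivFinsuppOfBasisRight b x i =
      contract k V Y x (b.coord i) := by
    intro x
    induction x using TensorProduct.induction_on with
    | zero => simp
    | add x y hx hy => simp only [map_add, LinearMap.add_apply, Finsupp.add_apply, hx, hy]
    | tmul y v => simp
  rw [key, hx]
  rfl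

/-- With a basis `b` of `U` and a projection `π` to `U`, the tensor is the sum of the `T (b.coord i
∘ π) ⊗ b i`, because a form on `V` matters only through its values on `U`. Finite dimension makes
the sum finite; this is how finite type of `R` enters. -/
theorem exists_contract_eq (U : Submodule k V) [Module.Finite k U] (T : Module.Dual k V →ₗ[k] Y)
    (hT : ∀ f : Module.Dual k V, (∀ u ∈ U, f u = 0) → T f = 0) :
    ∃ x ∈ Submodule.span k {x : Y ⊗[k] V | ∃ y, ∃ v ∈ U, x = y ⊗ₜ v}, contract k V Y x = T := by
  obtain ⟨π, hπ⟩ := LinearMap.exists_leftInverse_of_injective U.subtype U.ker_subtype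
  let b := Module.finBasis k U
  refine ⟨∑ i, T (b.coord i ∘ₗ π) ⊗ₜ (b i : V), Submodule.sum_mem _ fun i _ =>
    Submodule.subset_span ⟨_, _, (b i).2, rfl⟩, ?_⟩
  ext f
  rw [map_sum, LinearMap.sum_apply]
  simp only [contract_tmul]
  simp only [← map_smul]
  rw [← map_sum, ← sub_eq_zero, ← map_sub]
  refine hT _ fun u hu => ?_
  have h1 : π u = ⟨u, hu⟩ := LinearMap.congr_fun hπ ⟨u, hu⟩
  have h2 : ∑ i, b.repr ⟨u, hu⟩ i • (b i : V) = u := by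
    have := congrArg U.subtype (b.sum_repr ⟨u, hu⟩)
    rw [map_sum] at this
    exact this
  have h3 := congrArg f h2
  rw [map_sum] at h3
  simp only [map_smul, smul_eq_mul] at h3
  rw [LinearMap.sub_apply, sub_eq_zero, LinearMap.sum_apply, ← h3]
  refine Finset.sum_congr rfl fun i _ => ?_
  rw [LinearMap.smul_apply, LinearMap.comp_apply, h1, smul_eq_mul, mul_comm]
  rfl

end Contract

variable {R : WeightedDGCA.{u, v} k}

/-- The tensors in `Y ⊗ R` of total degree `n` and of weight `w`, if `Y` has weight `i`. -/
def shiftPart (R : WeightedDGCA.{u, v} k) (Y : Type*) [AddCommGroup Y] [Module k Y] (i n w : ℕ) :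
    Submodule k (Y ⊗[k] R) :=
  Submodule.span k {x | ∃ j, i + j = w ∧ ∃ y : Y, ∃ r ∈ R.part (n, j), x = y ⊗ₜ[k] r}

theorem rTensor_shiftPart {Y Y' : Type*} [AddCommGroup Y] [Module k Y] [AddCommGroup Y']
    [Module k Y'] (g : Y →ₗ[k] Y') {i n w : ℕ} {x : Y ⊗[k] R} (hx : x ∈ shiftPart R Y i n w) :
    g.rTensor R x ∈ shiftPart R Y' i n w := by
  have : shiftPart R Y i n w ≤ (shiftPart R Y' i n w).comap (g.rTensor R) := by
    refine Submodule.span_le.2 ?_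
    rintro _ ⟨j, hj, y, r, hr, rfl⟩
    exact Submodule.subset_span ⟨j, hj, g y, r, hr, by simp⟩
  exact this hx

theorem contract_eq_zero_of_mem_shiftPart {Y : Type*} [AddCommGroup Y] [Module k Y] {i n w : ℕ}
    {x : Y ⊗[k] R} (hx : x ∈ shiftPart R Y i n w) (f : Module.Dual k R)
    (hf : ∀ j, i + j = w → ∀ r ∈ R.part (n, j), f r = 0) : contract k R Y x f = 0 := by
  induction hx using Submodule.span_induction with
  | zero => simp
  | add x y _ _ hx hy => rw [map_add, LinearMap.add_apply, hx, hy, add_zero]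
  | smul a x _ hx => rw [map_smul, LinearMap.smul_apply, hx, smul_zero]
  | mem x hx =>
    obtain ⟨j, hj, y, r, hr, rfl⟩ := hx
    rw [contract_tmul, hf j hj r hr, zero_smul]

/-- At most one `j` satisfies `i + j = w`, so a single finite dimensional component of `R` is
involved; if there is none, `T` is zero. -/
theorem exists_mem_shiftPart_contract_eq (hR : R.IsFiniteType) {Y : Type*} [AddCommGroup Y]
    [Module k Y] {i n w : ℕ} (T : Module.Dual k R →ₗ[k] Y)
    (hT : ∀ f : Module.Dual k R, (∀ j, i + j = w → ∀ r ∈ R.part (n, j), f r = 0) → T f = 0) :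
    ∃ x ∈ shiftPart R Y i n w, contract k R Y x = T := by
  by_cases h : ∃ j, i + j = w
  · obtain ⟨j, hj⟩ := h
    have := hR (n, j)
    obtain ⟨x, hx, hx'⟩ := exists_contract_eq (R.part (n, j)) T fun f hf => hT f fun j' hj' => by
      obtain rfl : j' = j := by omega
      exact hf
    refine ⟨x, Submodule.span_mono ?_ hx, hx'⟩
    rintro _ ⟨y, r, hr, rfl⟩
    exact ⟨j, hj, y, r, hr, rfl⟩
  · refine ⟨0, Submodule.zero_mem _, ?_⟩
    ext f
    rw [hT f fun j hj => absurd ⟨j, hj⟩ h]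
    simp

/-! ### Subspaces of the base that cut out the kernel of the Kodaira-Spencer map. -/

namespace Deformation

variable (E : Deformation R A) (i : ℕ) (Y : Type*) [AddCommGroup Y] [Module k Y]

/-- The linear maps `μ : A → Y`, `Y` of weight `i`, for which `(μ ⊗ 1) ∘ e` is the commutator of
`d` and a derivation of `R` with values in `Y ⊗ R`. -/
def exactMaps : Submodule k (A →ₗ[k] Y) where
  carrier := {μ | ∃ θ : R →ₗ[k] Y ⊗[k] R,
    (∀ n w, ∀ r ∈ R.part (n, w), θ r ∈ shiftPart R Y i n w) ∧
    (∀ r s, θ (r * s) = (LinearMap.mulRight k s).lTensor Y (θ r) +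
      (LinearMap.mulLeft k r).lTensor Y (θ s)) ∧
    ∀ r, μ.rTensor R (E.e r) = R.d.lTensor Y (θ r) - θ (R.d r)}
  zero_mem' := ⟨0, by simp, by simp, by simp⟩
  add_mem' := by
    rintro μ ν ⟨θ, h₁, h₂, h₃⟩ ⟨η, h₄, h₅, h₆⟩
    refine ⟨θ + η, fun n w r hr => Submodule.add_mem _ (h₁ n w r hr) (h₄ n w r hr),
      fun r s => ?_, fun r => ?_⟩
    · simp only [LinearMap.add_apply, map_add, h₂, h₅]; abel
    · simp only [LinearMap.add_apply, map_add, LinearMap.rTensor_add, h₃, h₆]; abel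
  smul_mem' := by
    rintro c μ ⟨θ, h₁, h₂, h₃⟩
    refine ⟨c • θ, fun n w r hr => Submodule.smul_mem _ c (h₁ n w r hr),
      fun r s => ?_, fun r => ?_⟩
    · simp only [LinearMap.smul_apply, map_smul, h₂, smul_add]
    · simp only [LinearMap.smul_apply, map_smul, LinearMap.rTensor_smul, h₃, smul_sub]

variable {E i Y}

theorem comp_mem_exactMaps {Y' : Type*} [AddCommGroup Y'] [Module k Y'] (g : Y →ₗ[k] Y')
    {μ : A →ₗ[k] Y} (hμ : μ ∈ E.exactMaps i Y) : g ∘ₗ μ ∈ E.exactMaps i Y' := by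
  obtain ⟨θ, h₁, h₂, h₃⟩ := hμ
  refine ⟨g.rTensor R ∘ₗ θ, fun n w r hr => rTensor_shiftPart g (h₁ n w r hr),
    fun r s => ?_, fun r => ?_⟩
  · simp only [LinearMap.comp_apply, h₂, map_add, rTensor_lTensor]
  · rw [LinearMap.rTensor_comp, LinearMap.comp_apply, h₃]
    simp only [LinearMap.comp_apply, map_sub, rTensor_lTensor]

variable (E i)

/-- A subspace `N` of `A` that cuts out, in weight `i`, the kernel of the Kodaira-Spencer map. -/
structure IsKSSubspace (N : Submodule k A) : Prop where
  part_le : ∀ n, n ≠ i → A.part n ≤ N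
  sq_le : ∀ a ∈ A.maxIdeal ^ 2, a ∈ N
  eq_zero : ∀ t ∈ E.exactMaps i k, (∀ n, n ≠ i → ∀ a ∈ A.part n, t a = 0) →
    (∀ a ∈ A.maxIdeal ^ 2, t a = 0) → ∀ a ∈ N, t a = 0
  mem_exactMaps : ∀ (Y : Type u) [AddCommGroup Y] [Module k Y] (μ : A →ₗ[k] Y),
    (∀ a ∈ N, μ a = 0) → μ ∈ E.exactMaps i Y

/-- The kernel `K` in weight `i` embeds in the dual of `A.part i`, so it is finite dimensional and
equals the annihilator of its coannihilator `N`. A map that vanishes on `N` is then a finite sum of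
vectors times forms in `K`, each of which is exact. -/
theorem exists_isKSSubspace_of_finiteType_base (hA : A.IsFiniteType) :
    ∃ N, E.IsKSSubspace i N := by
  let K : Submodule k (Module.Dual k A) :=
    { carrier := {t | t ∈ E.exactMaps i k ∧ (∀ n, n ≠ i → ∀ a ∈ A.part n, t a = 0) ∧
        ∀ a ∈ A.maxIdeal ^ 2, t a = 0}
      zero_mem' := ⟨Submodule.zero_mem _, by simp, by simp⟩
      add_mem' := by
        rintro s t ⟨h₁, h₂, h₃⟩ ⟨h₄, h₅, h₆⟩
        exact ⟨Submodule.add_mem _ h₁ h₄, fun n hn a ha => by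
          rw [LinearMap.add_apply, h₂ n hn a ha, h₅ n hn a ha, add_zero], fun a ha => by
          rw [LinearMap.add_apply, h₃ a ha, h₆ a ha, add_zero]⟩
      smul_mem' := by
        rintro c t ⟨h₁, h₂, h₃⟩
        exact ⟨Submodule.smul_mem _ c h₁, fun n hn a ha => by
          rw [LinearMap.smul_apply, h₂ n hn a ha, smul_zero], fun a ha => by
          rw [LinearMap.smul_apply, h₃ a ha, smul_zero]⟩ }
  have hK : FiniteDimensional k K := by
    have := hA i
    let ρ : K →ₗ[k] Module.Dual k (A.part i) := (A.part i).subtype.dualMap ∘ₗ K.subtype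
    refine FiniteDimensional.of_injective ρ ?_
    rw [injective_iff_map_eq_zero]
    rintro ⟨t, ht⟩ h0
    refine Subtype.ext (LinearMap.ext fun a => ?_)
    induction a using WeightedAlgebra.part_induction with
    | zero => simp
    | add a b ha hb => rw [map_add, map_add, ha, hb]
    | mem n a ha =>
      by_cases hn : n = i
      · subst hn
        exact LinearMap.congr_fun h0 ⟨a, ha⟩
      · exact ht.2.1 n hn a ha
  let N := K.dualCoannihilator
  have hN : ∀ a, a ∈ N ↔ ∀ t ∈ K, t a = 0 := fun a => Submodule.mem_dualCoannihilator a
  refine ⟨N, fun n hn a ha => (hN a).2 fun t ht => ht.2.1 n hn a ha,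
    fun a ha => (hN a).2 fun t ht => ht.2.2 a ha,
    fun t h₁ h₂ h₃ a ha => (hN a).1 ha t ⟨h₁, h₂, h₃⟩, ?_⟩
  intro Y _ _ μ hμ
  have hfin : FiniteDimensional k (A ⧸ N) := Subspace.finiteDimensional_quot_dualCoannihilator_iff.2 hK
  let b := Module.finBasis k (A ⧸ N)
  have h1 : ∀ j, b.coord j ∘ₗ N.mkQ ∈ K := by
    intro j
    have : b.coord j ∘ₗ N.mkQ ∈ N.dualAnnihilator := by
      rw [Submodule.mem_dualAnnihilator]
      intro a ha
      rw [LinearMap.comp_apply, Submodule.mkQ_apply, (Submodule.Quotient.mk_eq_zero N).2 ha,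
        map_zero]
    rwa [Subspace.dualCoannihilator_dualAnnihilator_eq] at this
  have h2 : μ = ∑ j, LinearMap.toSpanSingleton k Y (N.liftQ μ hμ (b j)) ∘ₗ
      (b.coord j ∘ₗ N.mkQ) := by
    ext a
    have h3 : μ a = N.liftQ μ hμ (N.mkQ a) := rfl
    rw [h3, LinearMap.sum_apply]
    conv_lhs => rw [← b.sum_repr (N.mkQ a)]
    rw [map_sum]
    refine Finset.sum_congr rfl fun j _ => ?_
    rw [map_smul]
    rfl
  rw [h2]
  exact Submodule.sum_mem _ fun j _ => comp_mem_exactMaps _ (h1 j).1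

/-- A derivation `θ` is encoded by its contractions `T (r ⊗ f)`, with `f` in the dual of `R`. The
conditions on `T` form one linear system, the same for all `Y`, with right sides given by `μ`. Let
`N` be the set of `a` for which `0 = μ a` is a consequence. If `μ` vanishes on `N`, the system is
solvable, and finite type of `R` turns `T` back into a derivation. -/
theorem exists_isKSSubspace_of_finiteType_fibre (hR : R.IsFiniteType) :
    ∃ N, E.IsKSSubspace i N := by
  let D := Module.Dual k R
  -- The first three sets express the weight condition, the Leibniz rule and the commutator with
  -- `d`. The last two put `m²` and the other weights into `N`.
  let S : Set ((R ⊗[k] D) × A) :=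
    {p | ∃ n w, ∃ r ∈ R.part (n, w), ∃ f : D,
      (∀ j, i + j = w → ∀ r ∈ R.part (n, j), f r = 0) ∧ p = (r ⊗ₜ f, 0)} ∪
    {p | ∃ (r s : R) (f : D), p = ((r * s) ⊗ₜ f - r ⊗ₜ (f ∘ₗ LinearMap.mulRight k s) -
      s ⊗ₜ (f ∘ₗ LinearMap.mulLeft k r), 0)} ∪
    {p | ∃ (r : R) (f : D), p = (r ⊗ₜ (f ∘ₗ R.d) - R.d r ⊗ₜ f, contract k R A (E.e r) f)} ∪
    {p | ∃ a ∈ A.maxIdeal ^ 2, p = (0, a)} ∪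
    {p | ∃ n, n ≠ i ∧ ∃ a ∈ A.part n, p = (0, a)}
  let G := Submodule.span k S
  refine ⟨G.comap (LinearMap.inr k _ _), ?_, ?_, ?_, ?_⟩
  · exact fun n hn a ha => Submodule.subset_span (Or.inr ⟨n, hn, a, ha, rfl⟩)
  · exact fun a ha => Submodule.subset_span (Or.inl (Or.inr ⟨a, ha, rfl⟩))
  · rintro t ⟨θ, h₁, h₂, h₃⟩ h₄ h₅ a ha
    -- The derivation belonging to `t` solves the system with `μ = t`, so `t` satisfies all
    -- consequences `0 = t a`.
    let Φ : (R ⊗[k] D) × A →ₗ[k] k :=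
      LinearMap.coprod (TensorProduct.lift (contract k R k ∘ₗ θ)) (-t)
    have hΦ : G ≤ LinearMap.ker Φ := by
      refine Submodule.span_le.2 ?_
      rintro p ((((⟨n, w, r, hr, f, hf, rfl⟩ | ⟨r, s, f, rfl⟩) | ⟨r, f, rfl⟩) | ⟨a, ha, rfl⟩) |
        ⟨n, hn, a, ha, rfl⟩)
      · simp [Φ, contract_eq_zero_of_mem_shiftPart (h₁ n w r hr) f hf]
      · rw [SetLike.mem_coe, LinearMap.mem_ker, LinearMap.coprod_apply, map_zero, add_zero, map_sub,
          map_sub, TensorProduct.lift.tmul, TensorProduct.lift.tmul, TensorProduct.lift.tmul,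
          LinearMap.comp_apply, LinearMap.comp_apply, LinearMap.comp_apply, h₂, map_add,
          LinearMap.add_apply, contract_lTensor, contract_lTensor]
        abel
      · have h6 := congrArg (fun x => contract k R k x f) (h₃ r)
        simp only [map_sub, LinearMap.sub_apply, contract_lTensor, contract_rTensor] at h6
        simp [Φ, h6]
      · simp [Φ, h₅ a ha]
      · simp [Φ, h₄ n hn a ha]
    have h7 : Φ (0, a) = 0 := hΦ ha
    simpa [Φ] using h7
  · intro Y _ _ μ hμ
    obtain ⟨T, hT⟩ := exists_linearMap_of_forall_mem G μ hμ
    have hom : ∀ n w, ∀ r ∈ R.part (n, w), ∃ x ∈ shiftPart R Y i n w,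
        contract k R Y x = TensorProduct.curry T r := by
      intro n w r hr
      refine exists_mem_shiftPart_contract_eq hR _ fun f hf => ?_
      have := hT (r ⊗ₜ f, 0) (Submodule.subset_span
        (Or.inl (Or.inl (Or.inl (Or.inl ⟨n, w, r, hr, f, hf, rfl⟩)))))
      simpa using this
    have hrange : ∀ r, TensorProduct.curry T r ∈ LinearMap.range (contract k R Y) := by
      intro r
      induction r using WeightedDGCA.part_induction with
      | zero => rw [map_zero]; exact Submodule.zero_mem _
      | add a b ha hb => rw [map_add]; exact Submodule.add_mem _ ha hb
      | mem n w r hr =>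
        obtain ⟨x, -, hx⟩ := hom n w r hr
        exact ⟨x, hx⟩
    let θ : R →ₗ[k] Y ⊗[k] R :=
      (LinearEquiv.ofInjective (contract k R Y) contract_injective).symm.toLinearMap ∘ₗ
        (TensorProduct.curry T).codRestrict _ hrange
    have hθ : ∀ r f, contract k R Y (θ r) f = T (r ⊗ₜ f) := by
      intro r f
      have h1 : contract k R Y (θ r) = TensorProduct.curry T r :=
        congrArg Subtype.val ((LinearEquiv.ofInjective (contract k R Y)
          contract_injective).apply_symm_apply ⟨_, hrange r⟩)
      rw [h1, TensorProduct.curry_apply]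
    refine ⟨θ, fun n w r hr => ?_, fun r s => ?_, fun r => ?_⟩
    · obtain ⟨x, hx, hx'⟩ := hom n w r hr
      have : θ r = x := contract_injective (LinearMap.ext fun f => by
        rw [hθ, hx', TensorProduct.curry_apply])
      rwa [this]
    · refine contract_injective (LinearMap.ext fun f => ?_)
      have h1 := hT _ (Submodule.subset_span
        (Or.inl (Or.inl (Or.inl (Or.inr ⟨r, s, f, rfl⟩)))))
      rw [map_sub, map_sub, map_zero, sub_sub, sub_eq_zero] at h1
      rw [map_add, LinearMap.add_apply, contract_lTensor, contract_lTensor, hθ, hθ, hθ, h1]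
    · refine contract_injective (LinearMap.ext fun f => ?_)
      have h1 := hT _ (Submodule.subset_span (Or.inl (Or.inl (Or.inr ⟨r, f, rfl⟩))))
      rw [map_sub] at h1
      rw [map_sub, LinearMap.sub_apply, contract_lTensor, contract_rTensor, hθ, hθ, ← h1]

end Deformation

theorem WHom.exists_inverse {f : WHom A B} (hf : Function.Bijective f) :
    ∃ g : WHom B A, (∀ a, g (f a) = a) ∧ ∀ b, f (g b) = b := by
  let e := AlgEquiv.ofBijective f.toAlgHom hf
  refine ⟨⟨e.symm.toAlgHom, fun n b hb => ?_⟩, e.symm_apply_apply, e.apply_symm_apply⟩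
  have h : A.proj n (e.symm b) = e.symm b := hf.1 (by
    rw [WHom.map_proj]
    have h1 : f (e.symm b) = b := e.apply_symm_apply b
    rw [h1, proj_of_mem hb])
  change e.symm b ∈ A.part n
  rw [← h]
  exact proj_mem n _

/-! ### Exact maps as infinitesimal isomorphisms. -/

namespace Deformation

variable {R : WeightedDGCA.{u, v} k}

theorem mul_one_tmul (x : Z ⊗[k] R) (s : R) :
    x * 1 ⊗ₜ s = (LinearMap.mulRight k s).lTensor Z x := by
  induction x using TensorProduct.induction_on with
  | zero => simp
  | add x y hx hy => rw [add_mul, map_add, hx, hy]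
  | tmul z r => simp

theorem one_tmul_mul (x : Z ⊗[k] R) (s : R) :
    1 ⊗ₜ s * x = (LinearMap.mulLeft k s).lTensor Z x := by
  induction x using TensorProduct.induction_on with
  | zero => simp
  | add x y hx hy => rw [mul_add, map_add, hx, hy]
  | tmul z r => simp

theorem baseChange_eq_lTensor (x : Z ⊗[k] R) :
    R.d.baseChange Z x = R.d.lTensor Z x := rfl

theorem rTensor_subtype_mem_lowPart {i n w : ℕ} (hi : 0 < i) {x : Z.part i ⊗[k] R}
    (hx : x ∈ shiftPart R (Z.part i) i n w) :
    (Z.part i).subtype.rTensor R x ∈ lowPart R Z n w := by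
  have : shiftPart R (Z.part i) i n w ≤ (lowPart R Z n w).comap ((Z.part i).subtype.rTensor R) := by
    refine Submodule.span_le.2 ?_
    rintro _ ⟨j, hj, y, r, hr, rfl⟩
    exact Submodule.subset_span ⟨i, j, hi, hj, y, y.2, r, hr, by simp⟩
  exact this hx

theorem eq_zero_of_mem_shiftPart {Y : Type*} [AddCommGroup Y] [Module k Y] {i n w : ℕ}
    (hw : w < i) {x : Y ⊗[k] R} (hx : x ∈ shiftPart R Y i n w) : x = 0 := by
  have : shiftPart R Y i n w ≤ ⊥ := by
    refine Submodule.span_le.2 ?_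
    rintro _ ⟨j, hj, -⟩
    omega
  exact this hx

theorem rTensor_dualSnd_mem_shiftPart {i n w : ℕ} {hi : 0 < i} {x : dual k i hi ⊗[k] R}
    (hx : x ∈ lowPart R (dual k i hi) n w) :
    (dualSnd k i hi).rTensor R x ∈ shiftPart R k i n w := by
  have : lowPart R (dual k i hi) n w ≤
      (shiftPart R k i n w).comap ((dualSnd k i hi).rTensor R) := by
    refine Submodule.span_le.2 ?_
    rintro _ ⟨i', j, -, hij, z, hz, r, hr, rfl⟩
    rw [SetLike.mem_coe, Submodule.mem_comap, LinearMap.rTensor_tmul]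
    by_cases h : i' = i
    · subst h
      exact Submodule.subset_span ⟨j, hij, _, r, hr, rfl⟩
    · have h0 : dualSnd k i hi z = 0 := (mem_dual_part.1 hz).2 h
      rw [h0, TensorProduct.zero_tmul]
      exact Submodule.zero_mem _
  exact this hx

/-- Two families over a square zero base, pulled back along morphisms that differ by a sum of
exact linear maps, are isomorphic. -/
theorem isIso_map_of_exactMaps (E : Deformation R A) (hZ : Z.IsSquareZero) (f g : WHom A Z)
    (μ : ∀ i, A →ₗ[k] Z.part i) (hμ : ∀ i, μ i ∈ E.exactMaps i (Z.part i))
    (hμ0 : ∀ i n, n ≠ i → ∀ a ∈ A.part n, μ i a = 0)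
    (hfg : ∀ n, 0 < n → ∀ a ∈ A.part n, f a - g a = μ n a) : IsIso (E.map f) (E.map g) := by
  choose θ h₁ h₂ h₃ using hμ
  let η : ℕ → R →ₗ[k] Z ⊗[k] R := fun i => (Z.part i).subtype.rTensor R ∘ₗ θ i
  have hη0 : ∀ i n w, w < i → ∀ r ∈ R.part (n, w), η i r = 0 := fun i n w hw r hr => by
    rw [LinearMap.comp_apply, eq_zero_of_mem_shiftPart hw (h₁ i n w r hr), map_zero]
  have hηL : ∀ i r s, η i (r * s) = η i r * 1 ⊗ₜ s + 1 ⊗ₜ r * η i s := fun i r s => by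
    rw [mul_one_tmul, one_tmul_mul]
    simp only [η, LinearMap.comp_apply, h₂, map_add, rTensor_lTensor]
  have hηd : ∀ i r, ((Z.part i).subtype ∘ₗ μ i).rTensor R (E.e r) =
      R.d.baseChange Z (η i r) - η i (R.d r) := fun i r => by
    rw [LinearMap.rTensor_comp, LinearMap.comp_apply, h₃, baseChange_eq_lTensor]
    simp only [η, LinearMap.comp_apply, map_sub, rTensor_lTensor]
  -- The sum of all `η i` is finite on each component of `R`: in weight `w` only `i ≤ w` contribute.
  -- The index `0` is left out because the values must lie in `m_Z ⊗ R`.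
  obtain ⟨Θ, hΘ⟩ := exists_linearMap_of_isInternal R.part R.internal
    (fun p => ∑ i ∈ Finset.Ico 1 (p.2 + 1), η i)
  have hΘ' : ∀ n w, ∀ r ∈ R.part (n, w), ∀ W, w < W → Θ r = ∑ i ∈ Finset.Ico 1 W, η i r := by
    intro n w r hr W hW
    rw [hΘ (n, w) r hr, LinearMap.sum_apply]
    refine Finset.sum_subset (fun i hi => ?_) fun i hi hi' => ?_
    · rw [Finset.mem_Ico] at hi ⊢
      omega
    · rw [Finset.mem_Ico] at hi hi'
      exact hη0 i n w (by omega) r hr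
  have hdiff : ∀ n w, ∀ x ∈ lowPart R A n w, baseMap R f x - baseMap R g x =
      ∑ i ∈ Finset.Ico 1 (w + 1), ((Z.part i).subtype ∘ₗ μ i).rTensor R x := by
    intro n w x hx
    induction hx using Submodule.span_induction with
    | zero => simp
    | add x y _ _ hx hy =>
      simp only [map_add, Finset.sum_add_distrib, ← hx, ← hy]; abel
    | smul c x _ hx => simp only [map_smul, ← Finset.smul_sum, ← hx, smul_sub]
    | mem x hx =>
      obtain ⟨i, j, hi, hij, a, ha, r, hr, rfl⟩ := hx
      rw [baseMap_tmul, baseMap_tmul, ← TensorProduct.sub_tmul, hfg i hi a ha,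
        Finset.sum_eq_single_of_mem i (by rw [Finset.mem_Ico]; omega)]
      · simp
      · intro i' _ hne
        rw [LinearMap.rTensor_tmul, LinearMap.comp_apply, hμ0 i' i hne.symm a ha, map_zero,
          TensorProduct.zero_tmul]
  refine isIso_of_derivation hZ Θ ?_ ?_ ?_
  · intro n w r hr
    rw [hΘ' n w r hr (w + 1) (Nat.lt_succ_self w)]
    refine Submodule.sum_mem _ fun i hi => rTensor_subtype_mem_lowPart ?_ (h₁ i n w r hr)
    rw [Finset.mem_Ico] at hi
    omega
  · intro r s
    induction r using WeightedDGCA.part_induction with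
    | zero => simp
    | add a b ha hb => simp only [add_mul, map_add, TensorProduct.tmul_add, ha, hb]; abel
    | mem n w r hr =>
      induction s using WeightedDGCA.part_induction with
      | zero => simp
      | add a b ha hb => simp only [mul_add, map_add, TensorProduct.tmul_add, ha, hb]; abel
      | mem n' w' s hs =>
        -- A common range of summation for `r`, `s` and `r * s`; the surplus terms vanish.
        rw [hΘ' n w r hr (w + w' + 1) (by omega), hΘ' n' w' s hs (w + w' + 1) (by omega),
          hΘ' _ _ (r * s) (SetLike.GradedMul.mul_mem hr hs) (w + w' + 1) (Nat.lt_succ_self _),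
          Finset.sum_mul, Finset.mul_sum, ← Finset.sum_add_distrib]
        exact Finset.sum_congr rfl fun i _ => hηL i r s
  · intro r
    change baseMap R f (E.e r) - baseMap R g (E.e r) = _
    induction r using WeightedDGCA.part_induction with
    | zero => simp
    | add a b ha hb =>
      simp only [map_add]
      rw [add_sub_add_comm, ha, hb]; abel
    | mem n w r hr =>
      rw [hdiff _ w _ (E.mem_lowPart n w r hr), hΘ' n w r hr (w + 1) (Nat.lt_succ_self w),
        hΘ' _ w _ (R.d_mem n w r hr) (w + 1) (Nat.lt_succ_self w), map_sum,
        ← Finset.sum_sub_distrib]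
      exact Finset.sum_congr rfl fun i _ => hηd i r

/-- Tangent vectors that define isomorphic families differ by an exact linear form. -/
theorem IsIso.sub_mem_exactMaps {E : Deformation R A} {i : ℕ} {hi : 0 < i}
    {s t : WHom A (dual k i hi)} (h : IsIso (E.map s) (E.map t)) :
    dualSnd k i hi ∘ₗ (s.toAlgHom.toLinearMap - t.toAlgHom.toLinearMap) ∈ E.exactMaps i k := by
  obtain ⟨θ, h₁, h₂, h₃⟩ := h.exists_derivation (dual_isSquareZero i hi)
  refine ⟨(dualSnd k i hi).rTensor R ∘ₗ θ,
    fun n w r hr => rTensor_dualSnd_mem_shiftPart (h₁ n w r hr), fun r r' => ?_, fun r => ?_⟩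
  · rw [LinearMap.comp_apply, h₂, mul_one_tmul, one_tmul_mul, map_add, rTensor_lTensor,
      rTensor_lTensor]
    rfl
  · have h4 := congrArg ((dualSnd k i hi).rTensor R) (h₃ r)
    rw [map_sub _ (R.d.baseChange _ _), baseChange_eq_lTensor, rTensor_lTensor] at h4
    rw [LinearMap.comp_apply, LinearMap.comp_apply, ← h4, LinearMap.rTensor_comp,
      LinearMap.rTensor_sub]
    rfl

/-! ### Slicing a versal family to a miniversal one. -/

/-- If the kernels of the Kodaira-Spencer maps of a versal family are cut out by subspaces of the
base, the family restricts to a miniversal one. -/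
theorem IsVersal.exists_isMiniversal {E : Deformation R A} (hE : E.IsVersal)
    (hKS : ∀ i, ∃ N, E.IsKSSubspace i N) :
    ∃ (B : WeightedAlgebra k) (F : Deformation R B), F.IsMiniversal := by
  choose N₀ hN₀ using hKS
  let N : ℕ → Submodule k A := fun i => if i = 0 then ⊤ else N₀ i
  have hN : ∀ i, 0 < i → N i = N₀ i := fun i hi => if_neg hi.ne'
  have hN0 : N 0 = ⊤ := if_pos rfl
  have hNpart : ∀ i n, n ≠ i → A.part n ≤ N i := by
    intro i n hn
    rcases Nat.eq_zero_or_pos i with rfl | hi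
    · rw [hN0]; exact le_top
    · rw [hN i hi]; exact (hN₀ i).part_le n hn
  have hNsq : ∀ i, ∀ a ∈ A.maxIdeal ^ 2, a ∈ N i := by
    intro i a ha
    rcases Nat.eq_zero_or_pos i with rfl | hi
    · rw [hN0]; trivial
    · rw [hN i hi]; exact (hN₀ i).sq_le a ha
  obtain ⟨σ, c, hc, l, q, hl, hq0, hqm, hqs, hql, hqψ⟩ := exists_coordinates N hN0 hNpart
  obtain ⟨q', hq'⟩ := exists_linearMap_of_isInternal A.part A.internal q
  have hq'sq : ∀ a ∈ A.maxIdeal ^ 2, q' a = 0 := fun a ha =>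
    eq_zero_of_forall_proj hq' fun n =>
      hq0 n _ (hNsq n _ (proj_mem_of_isHomogeneous maxIdeal_sq_isHomogeneous n ha))
  have hq'1 : q' 1 = 0 := by
    rw [hq' 0 1 SetLike.GradedOne.one_mem]
    exact hq0 0 1 (by rw [hN0]; trivial)
  let P := tensor A (poly k c hc)
  let inl : WHom A P := tensorInl A (poly k c hc)
  let inr : WHom (poly k c hc) P := tensorInr A (poly k c hc)
  -- `f'` displaces the inclusion of `A` by the coordinates `q'` on the Kodaira-Spencer kernels. The
  -- displacement vanishes on the `N i`, so it is exact, and both morphisms induce isomorphic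
  -- families over `P / m²`.
  obtain ⟨f', hf'⟩ := WHom.exists_add (firstOrder_isSquareZero (A := P))
    (P.toFirstOrder.comp inl)
    (P.toFirstOrder.toAlgHom.toLinearMap ∘ₗ inr.toAlgHom.toLinearMap ∘ₗ q')
    (fun n a ha => P.toFirstOrder.map_mem n _ (inr.map_mem n _ (by rw [hq' n a ha]; exact hqm n a)))
    (by simp [hq'1]) (fun a ha => by simp [hq'sq a ha])
  replace hf' : ∀ a, f' a = P.toFirstOrder (inl a) + P.toFirstOrder (inr (q' a)) := hf'
  let μ : ∀ i, A →ₗ[k] P.firstOrder.part i := fun i =>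
    (P.toFirstOrder.toAlgHom.toLinearMap ∘ₗ inr.toAlgHom.toLinearMap ∘ₗ q i).codRestrict _
      fun a => P.toFirstOrder.map_mem i _ (inr.map_mem i _ (hqm i a))
  have hμ0 : ∀ i, ∀ a ∈ N i, μ i a = 0 := fun i a ha => Subtype.ext (by
    change P.toFirstOrder (inr (q i a)) = 0
    rw [hq0 i a ha, map_zero, map_zero])
  have hiso : IsIso (E.map f') ((E.map inl).map P.toFirstOrder) := by
    rw [map_map]
    refine isIso_map_of_exactMaps E firstOrder_isSquareZero _ _ μ (fun i => ?_)
      (fun i n hn a ha => hμ0 i a (hNpart i n hn ha)) fun n hn a ha => ?_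
    · rcases Nat.eq_zero_or_pos i with rfl | hi
      · have : μ 0 = 0 := LinearMap.ext fun a => hμ0 0 a (by rw [hN0]; trivial)
        rw [this]
        exact Submodule.zero_mem _
      · exact (hN₀ i).mem_exactMaps _ _ fun a ha => hμ0 i a (by rwa [hN i hi])
    · rw [hf', WHom.comp_apply, add_sub_cancel_left, hq' n a ha]
      rfl
  -- Versality integrates the displacement: `φ` is a map `Spec A × Spec C → Spec A` along which `E`
  -- pulls back to the same family as along the projection.
  obtain ⟨φ, hφ, hφ'⟩ := hE.exists_lift P.toFirstOrder toFirstOrder_surjective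
    firstOrder_isSquareZero f' (E.map inl) hiso
  have hφa : ∀ a, P.toFirstOrder (φ a) = P.toFirstOrder (inl a + inr (q' a)) := fun a => by
    rw [map_add, ← hf', ← hφ]; rfl
  -- Implicit function theorem: the `φ (l s) - l s` can replace the variables as coordinates of `P`
  -- over `A`. Setting them to `-l s` defines a retraction `ρ : P → A` with `ρ (φ (l s)) = 0`, a
  -- choice of parameters that moves every point into the slice.
  let χ : WHom P P := inl.tensorLift (polyLift hc (fun s => φ (l s) - inl (l s)) fun s =>
    Submodule.sub_mem _ (φ.map_mem _ _ (hl s)) (inl.map_mem _ _ (hl s)))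
  have hχl : ∀ a, χ (inl a) = inl a := fun a => WHom.tensorLift_inl _ _ a
  have hχr : ∀ s, χ (inr (polyVar hc s)) = φ (l s) - inl (l s) := fun s => by
    rw [WHom.tensorLift_inr, polyLift_polyVar]
  have hχr' : ∀ s, P.toFirstOrder (χ (inr (polyVar hc s))) =
      P.toFirstOrder (inr (polyVar hc s)) := fun s => by
    rw [hχr, map_sub P.toFirstOrder.toAlgHom, hφa, hq' _ _ (hl s), hql, map_add,
      add_sub_cancel_left]
  have hχ : P.toFirstOrder.comp χ = P.toFirstOrder := by
    refine WHom.tensor_ext (fun a => ?_) fun x => ?_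
    · rw [WHom.comp_apply]
      exact congrArg P.toFirstOrder.toAlgHom (hχl a)
    · have : P.toFirstOrder.comp (χ.comp inr) = P.toFirstOrder.comp inr :=
        WHom.poly_ext hχr'
      exact congrArg (fun t : WHom (poly k c hc) P.firstOrder => t x) this
  obtain ⟨χ', hχ'1, -⟩ := WHom.exists_inverse (WHom.bijective_of_toFirstOrder_comp hχ)
  let ψ : WHom P A := (WHom.id A).tensorLift (polyLift hc (fun s => - l s) fun s =>
    Submodule.neg_mem _ (hl s))
  let ρ : WHom P A := ψ.comp χ'
  have hρχ : ∀ x, ρ (χ x) = ψ x := fun x => by rw [WHom.comp_apply, hχ'1]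
  have hρl : ∀ a, ρ (inl a) = a := fun a => by
    rw [← hχl, hρχ]
    exact WHom.tensorLift_inl _ _ a
  have hψr : ∀ s, ψ (inr (polyVar hc s)) = - l s := fun s => by
    rw [WHom.tensorLift_inr, polyLift_polyVar]
  have hρφ : ∀ s, ρ (φ (l s)) = 0 := fun s => by
    have h1 := hρχ (inr (polyVar hc s))
    rw [hχr, hψr, map_sub ρ.toAlgHom, hρl] at h1
    linear_combination h1
  let J : Ideal A := Ideal.span (Set.range l)
  have hJ : J.IsHomogeneous A.part := by
    refine Ideal.homogeneous_span _ _ ?_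
    rintro _ ⟨s, rfl⟩
    exact ⟨c s, hl s⟩
  have hJle : J ≤ A.maxIdeal := by
    refine Ideal.span_le.2 ?_
    rintro _ ⟨s, rfl⟩
    exact mem_maxIdeal_of_part (hc s) (hl s)
  let π : WHom A (A.quot J hJ hJle) := mkQuot J hJ hJle
  have hπl : ∀ s, π (l s) = 0 := fun s => by
    rw [← map_zero π.toAlgHom]
    refine mkQuot_eq_iff.2 ?_
    rw [sub_zero]
    exact Ideal.subset_span ⟨s, rfl⟩
  -- Since `ρ` is the identity on `A`, the family induced from `E` by `ρ ∘ φ` is isomorphic to `E`.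
  -- So `E` is induced by `g` from its restriction to the slice.
  let g : WHom (A.quot J hJ hJle) A := liftQuot J hJ hJle (ρ.comp φ) (by
    have : J ≤ RingHom.ker (ρ.comp φ).toAlgHom := by
      refine Ideal.span_le.2 ?_
      rintro _ ⟨s, rfl⟩
      exact hρφ s
    exact fun a ha => this ha)
  have hgπ : g.comp π = ρ.comp φ := rfl
  have hg : IsIso ((E.map π).map g) E := by
    have h1 := hφ'.map ρ
    have h2 : ρ.comp inl = WHom.id A := WHom.ext hρl
    rw [map_map, map_map, h2, map_id, ← hgπ, ← map_map] at h1
    exact h1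
  have hspan : ∀ x ∈ Submodule.span k (Set.range (polyVar hc)),
      (A.quot J hJ hJle).toFirstOrder (π (ρ (inr x))) = 0 := by
    intro x hx
    induction hx using Submodule.span_induction with
    | zero => simp only [map_zero]
    | add x y _ _ hx hy => simp only [map_add, hx, hy, add_zero]
    | smul a x _ hx => simp only [map_smul, hx, smul_zero]
    | mem x hx =>
      obtain ⟨s, rfl⟩ := hx
      have h1 : _ = (A.quot J hJ hJle).toFirstOrder (π (ρ (inr (polyVar hc s)))) :=
        toFirstOrder_comp_congr (π.comp ρ) (hχr' s)
      rw [WHom.comp_apply, hρχ, hψr, map_neg, hπl, neg_zero, map_zero] at h1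
      exact h1.symm
  have hπg : (A.quot J hJ hJle).toFirstOrder.comp (π.comp g) =
      (A.quot J hJ hJle).toFirstOrder := by
    refine WHom.ext_part fun n hn b hb => ?_
    obtain ⟨a, ha, rfl⟩ := exists_mem_part_of_quot hb
    have h1 : _ = (A.quot J hJ hJle).toFirstOrder (π (ρ (inl a + inr (q' a)))) :=
      toFirstOrder_comp_congr (π.comp ρ) (hφa a)
    rw [map_add ρ.toAlgHom, map_add, map_add, hρl,
      hspan _ (by rw [hq' n a ha]; exact hqs n a), add_zero] at h1
    exact h1
  -- A lift over `A` is composed with `g`. It remains a lift because `π ∘ g` is the identity modulo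
  -- `m²` and `B₂` is square zero.
  have hF : (E.map π).IsVersal := by
    refine isVersal_of_exists_lift fun B₁ B₂ p hp hB₂ f'' G hG => ?_
    rw [map_map] at hG
    obtain ⟨f, hf, hfG⟩ := hE.exists_lift p hp hB₂ _ G hG
    refine ⟨f.comp g, ?_, ?_⟩
    · rw [← WHom.comp_assoc, hf, WHom.comp_assoc]
      exact WHom.ext fun b => IsSquareZero.map_congr hB₂ f''
        (congrArg (fun t : WHom (A.quot J hJ hJle) _ => t b) hπg)
    · rw [← map_map]
      exact (hg.map f).trans hfG
  refine ⟨A.quot J hJ hJle, E.map π, hF, fun i hi => ⟨fun t₁ t₂ h => ?_, fun m => ?_⟩⟩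
  · rw [classify_eq_iff, map_map, map_map] at h
    -- `τ` is exact, so it vanishes on `N i`. Both tangent vectors come from the slice, so it also
    -- vanishes on every `l s`. These together span `A`.
    let τ : A →ₗ[k] k := dualSnd k i hi ∘ₗ
      ((t₁.comp π).toAlgHom.toLinearMap - (t₂.comp π).toAlgHom.toLinearMap)
    have hτ : ∀ a, τ a = dualSnd k i hi (t₁ (π a)) - dualSnd k i hi (t₂ (π a)) := fun a =>
      map_sub (dualSnd k i hi) _ _
    have h0 : ∀ n, n ≠ i → ∀ x ∈ (dual k i hi).part n, dualSnd k i hi x = 0 :=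
      fun n hn x hx => (mem_dual_part.1 hx).2 hn
    have hτN : ∀ a ∈ N i, τ a = 0 := by
      rw [hN i hi]
      refine (hN₀ i).eq_zero τ h.sub_mem_exactMaps (fun n hn a ha => ?_) fun a ha => ?_
      · rw [hτ, h0 n hn _ (t₁.map_mem n _ (π.map_mem n a ha)),
          h0 n hn _ (t₂.map_mem n _ (π.map_mem n a ha)), sub_zero]
      · have h1 := (dual_isSquareZero i hi).map_eq_zero t₁ (map_maxIdeal_sq_mem π ha)
        have h2 := (dual_isSquareZero i hi).map_eq_zero t₂ (map_maxIdeal_sq_mem π ha)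
        rw [hτ, h1, h2, sub_self]
    have hτspan : ∀ x ∈ Submodule.span k (Set.range (polyVar hc)),
        τ (polyLift hc l hl x) = 0 := by
      intro x hx
      induction hx using Submodule.span_induction with
      | zero => simp only [map_zero]
      | add x y _ _ hx hy => simp only [map_add, hx, hy, add_zero]
      | smul a x _ hx => simp only [map_smul, hx, smul_zero]
      | mem x hx =>
        obtain ⟨s, rfl⟩ := hx
        rw [polyLift_polyVar, hτ, hπl, map_zero t₁.toAlgHom, map_zero t₂.toAlgHom, map_zero, sub_self]
    have hτ0 : ∀ a, τ a = 0 := by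
      intro a
      have h1 := hτN _ (hqψ i a (polyLift hc l hl).toAlgHom.toLinearMap (polyLift_polyVar l hl))
      rw [map_sub, AlgHom.toLinearMap_apply, hτspan _ (hqs i a), sub_zero] at h1
      exact h1
    refine WHom.ext_part fun n hn b hb => ?_
    obtain ⟨a, ha, rfl⟩ := exists_mem_part_of_quot hb
    refine dual_ext_part hn (t₁.map_mem n _ hb) (t₂.map_mem n _ hb) ?_
    exact sub_eq_zero.1 ((hτ a).symm.trans (hτ0 a))
  · induction m using Quotient.inductionOn with
    | _ G =>
      obtain ⟨t, ht⟩ := hF.exists_isIso G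
      exact ⟨t, Quotient.sound ht⟩

end Deformation

end

end WeightedDeformation

theorem mainTheorem6 {k : Type u} [Field k] [CharZero k]
    (H : WeightedDeformation.SimplyConnectedCGA.{u, w} k)
    (R : WeightedDeformation.WeightedDGCA.{u, v} k)
    (M : WeightedDeformation.WeightedModel R H) :
    (∀ (A : WeightedDeformation.WeightedAlgebra k) (E : WeightedDeformation.Deformation R A),
      E.IsVersal →
        (R.IsFiniteType ∨ A.IsFiniteType →
          ∃ (B : WeightedDeformation.WeightedAlgebra k) (F : WeightedDeformation.Deformation R B),
            F.IsMiniversal ∧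
            ∃ (σ : Type u) (c : σ → ℕ) (hc : ∀ s, 0 < c s),
              E.FamilyIso (F.prodTrivial (WeightedDeformation.poly k c hc))) ∧
        (∀ (B : WeightedDeformation.WeightedAlgebra k) (F : WeightedDeformation.Deformation R B),
          F.IsMiniversal →
            ∃ (σ : Type u) (c : σ → ℕ) (hc : ∀ s, 0 < c s),
              E.FamilyIso (F.prodTrivial (WeightedDeformation.poly k c hc)))) ∧
    (∀ (B B' : WeightedDeformation.WeightedAlgebra k)
      (F : WeightedDeformation.Deformation R B) (F' : WeightedDeformation.Deformation R B'),
      F.IsMiniversal → F'.IsMiniversal → F.FamilyIso F') := by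
  refine ⟨fun A E hE => ⟨fun hfin => ?_, fun B F hF => hE.exists_familyIso hF⟩,
    fun B B' F F' hF hF' => hF.familyIso hF'⟩
  have hKS : ∀ i, ∃ N, E.IsKSSubspace i N := fun i => hfin.elim
    (fun hR => E.exists_isKSSubspace_of_finiteType_fibre i hR)
    (fun hA => E.exists_isKSSubspace_of_finiteType_base i hA)
  obtain ⟨B, F, hF⟩ := hE.exists_isMiniversal hKS
  exact ⟨B, F, hF, hE.exists_familyIso hF⟩
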